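/- Let $T$ be a complete first-order theory with infinite models in a language $L$; "definable" means definable without parameters. For a linear order $<$ on a set $X$ and an equivalence relation $E$ on $X$ whose classes are all $<$-convex, let $<_E$ be the linear order given by: $x<_E y$ iff ($E(x,y)$ and $y<x$) or ($\neg E(x,y)$ and $x<y$). A finite sequence $\vec E=(E_0,\dots,E_{n-1})$ of equivalence relations on $X$ is $<$-admissible if $E_0$ has $<$-convex classes, $E_1$ has $<_{E_0}$-convex classes, $E_2$ has $(<_{E_0})_{E_1}$-convex classes, etc.; then $<_{\vec E}$ denotes $(\cdots(<_{E_0})_{E_1}\cdots)_{E_{n-1}}$ (which is $<$ if $n=0$). For linear orders $<$ and $\lhd$ on $X$, a relation $R\subseteq X\times X$ is $(<,\lhd)$-monotone if $a\leqslant a'$, $(a',b')\in R$ and $b'\trianglelefteq b$ imply $(a,b)\in R$. If $<$ is a definable linear order on a model $M$ of $T$, a definable relation $R\subseteq M^2$ is called special monotone with respect to $<$ if it is $(<,<_{\vec E})$-monotone for some $<$-admissible sequence $\vec E$ of definable equivalence relations, and weakly monotone with respect to $<$ if $\vec E$ can moreover be chosen decreasing (each $E_{i+1}$ refines $E_i$).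 Suppose that $T$ is weakly quasi-o-minimal, that is, there is an $L$-formula defining a linear order $<$ on each model of $T$ such that in every model of $T$ each subset definable with parameters is a finite Boolean combination of $<$-convex sets and sets definable without parameters. Let $M$ be a model of $T$. Then: (1) The complete theory of the full binary reduct of $M$ (the structure on $M$ obtained by naming all definable subsets of $M$ and of $M^2$) eliminates quantifiers. (2) For every definable linear order $<$ on $M$, every definable $R\subseteq M^2$ is a finite Boolean combination of sets of the form $D\times M$ and $M\times D$ with $D\subseteq M$ definable and of relations that are weakly monotone with respect to $<$. In particular, it is a finite Boolean combination of sets of the form $D\times M$ and $M\times D$ with $D\subseteq M$ definable and of relations that are special monotone with respect to $<$. -/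

import Mathlib

universe u v w

namespace WQOM

/-! ### Linear orders on a set; orders are given by their strict relation -/

section Orders

variable {X : Type w}

/-- `D` is convex with respect to the order `r`. -/
def IsConvex (r : X → X → Prop) (D : Set X) : Prop :=
  ∀ a ∈ D, ∀ b ∈ D, ∀ c, r a c → r c b → c ∈ D

/-- `E` is an equivalence relation all of whose classes are convex with respect to `r`. -/
def IsConvexEquiv (r E : X → X → Prop) : Prop :=
  Equivalence E ∧ ∀ a, IsConvex r {x | E a x}

/-- The order `r_E`: it reverses `r` inside each `E`-class and keeps the `r`-order
between distinct classes. -/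
def flipOrder (r E : X → X → Prop) (x y : X) : Prop :=
  (E x y ∧ r y x) ∨ (¬ E x y ∧ r x y)

/-- The iterated order `(⋯((r_{E₀})_{E₁})⋯)_{Eₙ₋₁}` for the sequence `[E₀, …, Eₙ₋₁]`. -/
def seqOrder : (X → X → Prop) → List (X → X → Prop) → X → X → Prop
  | r, [] => r
  | r, E :: Es => seqOrder (flipOrder r E) Es

/-- `[E₀, …, Eₙ₋₁]` is `r`-admissible: `E₀` is an `r`-convex equivalence relation, `E₁` is an
`r_{E₀}`-convex equivalence relation, `E₂` is an `(r_{E₀})_{E₁}`-convex one, etc. -/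
def IsAdmissible : (X → X → Prop) → List (X → X → Prop) → Prop
  | _, [] => True
  | r, E :: Es => IsConvexEquiv r E ∧ IsAdmissible (flipOrder r E) Es

/-- Later members of the sequence refine the earlier ones. -/
def IsDecreasing (Es : List (X → X → Prop)) : Prop :=
  Es.Pairwise fun E F => ∀ x y, F x y → E x y

/-- `R` is a monotone(-increasing) relation between `(X, r)` and `(X, s)`:
`a ≤ᵣ a'`, `a' R b'` and `b' ≤ₛ b` imply `a R b`. -/
def IsMonotoneRel (r s : X → X → Prop) (R : Set (X × X)) : Prop :=
  ∀ a a' b' b, (a = a' ∨ r a a') → (a', b') ∈ R → (b' = b ∨ s b' b) → (a, b) ∈ R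

end Orders

/-! ### Definable relations in a structure (definable always means without parameters) -/

section Structures

variable (L : FirstOrder.Language.{u, v}) {M : Type w} [L.Structure M]

/-- The binary relation `r` is definable without parameters. -/
def DefinableRel (r : M → M → Prop) : Prop :=
  (∅ : Set M).Definable₂ L {p : M × M | r p.1 p.2}

/-- The orders `r_E` for admissible sequences `E` of definable equivalence relations. -/
def specialOrders (r : M → M → Prop) : Set (M → M → Prop) :=
  {s | ∃ Es : List (M → M → Prop),
    (∀ E ∈ Es, DefinableRel L E) ∧ IsAdmissible r Es ∧ s = seqOrder r Es}

/-- The orders `r_E` for decreasing admissible sequences `E` of definable equivalence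
relations. -/
def weakOrders (r : M → M → Prop) : Set (M → M → Prop) :=
  {s | ∃ Es : List (M → M → Prop), (∀ E ∈ Es, DefinableRel L E) ∧ IsAdmissible r Es ∧
    IsDecreasing Es ∧ s = seqOrder r Es}

/-- The definable relations that are `(r, s)`-monotone for some `s ∈ F`. -/
def monotoneRels (r : M → M → Prop) (F : Set (M → M → Prop)) : Set (Set (M × M)) :=
  {R | (∅ : Set M).Definable₂ L R ∧ ∃ s ∈ F, IsMonotoneRel r s R}

/-- Special monotone relations with respect to `r`. -/
def specialMonotoneRels (r : M → M → Prop) : Set (Set (M × M)) :=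
  monotoneRels L r (specialOrders L r)

/-- Weakly monotone relations with respect to `r`. -/
def weaklyMonotoneRels (r : M → M → Prop) : Set (Set (M × M)) :=
  monotoneRels L r (weakOrders L r)

variable (M) in
/-- The binary sets given by a unary definable set applied to the first or to the second
variable. -/
def unarySets : Set (Set (M × M)) :=
  {R | ∃ D : Set M, (∅ : Set M).Definable₁ L D ∧
    (R = {p : M × M | p.1 ∈ D} ∨ R = {p : M × M | p.2 ∈ D})}

variable (M) in
/-- The language of the full binary reduct of `M`: no function symbols, and one relation symbol
for each definable unary set and for each definable binary set. -/
def binLanguage : FirstOrder.Language.{0, w} where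
  Functions := fun _ => Empty
  Relations := fun n => {S : Set (Fin n → M) // (n = 1 ∨ n = 2) ∧ (∅ : Set M).Definable L S}

variable (M) in
/-- The full binary reduct of `M`. -/
instance binReduct : (binLanguage L M).Structure M where
  funMap := fun f => f.elim
  RelMap := fun S x => x ∈ S.1

end Structures

/-! ### Theories -/

section Theories

variable {L : FirstOrder.Language.{u, v}}

/-- Every formula is equivalent modulo `T` to a quantifier-free formula in the same variables. -/
def EliminatesQuantifiers (T : L.Theory) : Prop :=
  ∀ (n : ℕ) (φ : L.Formula (Fin n)), ∃ ψ : L.Formula (Fin n),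
    FirstOrder.Language.BoundedFormula.IsQF ψ ∧ T.Iff φ ψ

/-- `T` is weakly quasi-o-minimal with respect to the formula `lt`: in every model `M` of `T`,
`lt` defines a linear order, and every subset of `M` definable with parameters is a finite Boolean
combination of convex sets and of sets definable without parameters. (By Löwenheim–Skolem,
models in the universe of the language suffice.) -/
def IsWeaklyQuasiOMinimalWrt (T : L.Theory) (lt : L.Formula (Fin 2)) : Prop :=
  ∀ M : FirstOrder.Language.Theory.ModelType.{u, v, max u v} T,
    IsStrictTotalOrder M (fun a b => lt.Realize ![a, b]) ∧
    ∀ D : Set M, (Set.univ : Set M).Definable₁ L D →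
      D ∈ BooleanSubalgebra.closure
        ({C : Set M | IsConvex (fun a b => lt.Realize ![a, b]) C} ∪
          {C : Set M | (∅ : Set M).Definable₁ L C})

/-- `T` is weakly quasi-o-minimal: it is so with respect to some definable linear order. -/
def IsWeaklyQuasiOMinimal (T : L.Theory) : Prop :=
  ∃ lt : L.Formula (Fin 2), IsWeaklyQuasiOMinimalWrt T lt

end Theories

end WQOM

/-! Everything rests on uniform tameness of an order `r` (`UniformlyTame`): for each definable `S`,
the model is a finite union of definable pieces on which the sets `{u | S b u}` change membership
along `r` a bounded number of times, uniformly in `b`. For the distinguished order this is weak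
quasi-o-minimality plus compactness: one set definable with parameters is tame on the classes of a
finite set of formulas, and compactness makes these formulas and the bound independent of the
parameter (`IsWeaklyQuasiOMinimalWrt.uniformlyTame`).

The core is `finCover_resolvedOn`, which compares a tame order with a second definable order `q`.
Colour a pair `x < y` by whether `q` reverses it, and induct on the length of colour-alternating
chains above a point inside its class for a convex equivalence `E`. Points whose longest chains end
in colour `s` see only colour `s` from some place on; `y` is tied to `x` if colour `!s` still occurs
at or above `y`. Stratifying by the depth of "crossings", which is bounded because the sets `{u | q
u z}` are uniformly tame, and passing to full parts makes the hulls of ties the classes of a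
definable convex equivalence `F`. Pairs in `E` but not in `F` all have colour `s`, and chains inside
`F`-classes are shorter. Hence on each piece of a finite definable cover, `q` is `r_E` for a
decreasing sequence. Reversing convex classes preserves tameness (`TameOn.flipOrder`), so every
definable order is uniformly tame.

For (2), counting alternations reduces a binary relation to relations with up-closed fibres over the
second variable (`mem_closure_upRels`). Such fibres form a chain under inclusion, which yields a
definable order on the parameters (`fiberOrder`); on each piece it is some `r_E`, and this makes the
complement the trace of a weakly monotone relation. For (1), sets given by binary conditions split
into cells: an up-set depending on one coordinate, met with a down-set depending on one coordinate.
Whether such an intersection meets a definable set is again a binary condition, so projections stay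
in the algebra (`exists_mem_binAlgebra`). -/

namespace WQOM

/-! ### Closure properties of parameter-free definability. -/

section Definability

variable {L : FirstOrder.Language.{u, v}} {M : Type w} [L.Structure M] {n : ℕ}

variable (L) in
/-- The `n`-ary predicate `P` is definable without parameters. -/
def DefPred (P : (Fin n → M) → Prop) : Prop :=
  (∅ : Set M).Definable L {v | P v}

/-- `f` is one of the coordinate functions. -/
def IsCoord (f : (Fin n → M) → M) : Prop :=
  ∃ i, ∀ v, f v = v i

namespace DefPred

variable {P Q : (Fin n → M) → Prop}

theorem and (hP : DefPred L P) (hQ : DefPred L Q) : DefPred L fun v => P v ∧ Q v :=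
  Set.Definable.inter hP hQ

theorem or (hP : DefPred L P) (hQ : DefPred L Q) : DefPred L fun v => P v ∨ Q v :=
  Set.Definable.union hP hQ

theorem not (hP : DefPred L P) : DefPred L fun v => ¬ P v :=
  Set.Definable.compl hP

theorem imp (hP : DefPred L P) (hQ : DefPred L Q) : DefPred L fun v => P v → Q v := by
  have := hP.not.or hQ
  simpa only [imp_iff_not_or] using this

theorem iff (hP : DefPred L P) (hQ : DefPred L Q) : DefPred L fun v => (P v ↔ Q v) := by
  have := (hP.imp hQ).and (hQ.imp hP)
  simpa only [← iff_iff_implies_and_implies] using this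

theorem const (p : Prop) : DefPred L fun _ : Fin n → M => p := by
  by_cases hp : p
  · simp [DefPred, hp, Set.definable_univ]
  · simp [DefPred, hp, Set.definable_empty]

theorem comp {m : ℕ} {P : (Fin m → M) → Prop} (hP : DefPred L P) {f : Fin m → (Fin n → M) → M}
    (hf : ∀ i, IsCoord (f i)) : DefPred L fun v => P fun i => f i v := by
  choose σ hσ using hf
  have := Set.Definable.preimage_comp σ hP
  simp only [hσ]
  exact this

theorem ex {P : (Fin n → M) → M → Prop}
    (hP : DefPred L fun v : Fin (n + 1) → M => P (Fin.tail v) (v 0)) :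
    DefPred L fun v => ∃ z, P v z := by
  have := Set.Definable.image_comp hP (Fin.succ : Fin n → Fin (n + 1))
  refine (congrArg (Set.Definable _ L) ?_).mp this
  ext v
  constructor
  · rintro ⟨w, hw, rfl⟩
    exact ⟨w 0, hw⟩
  · rintro ⟨z, hz⟩
    exact ⟨Fin.cons z v, by simpa using hz, by ext i; simp⟩

theorem all {P : (Fin n → M) → M → Prop}
    (hP : DefPred L fun v : Fin (n + 1) → M => P (Fin.tail v) (v 0)) :
    DefPred L fun v => ∀ z, P v z := by
  have := (ex (P := fun v z => ¬ P v z) hP.not).not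
  simpa only [not_exists, not_not] using this

theorem eq {f g : (Fin n → M) → M} (hf : IsCoord f) (hg : IsCoord g) :
    DefPred L fun v => f v = g v := by
  obtain ⟨i, hi⟩ := hf
  obtain ⟨j, hj⟩ := hg
  simp only [hi, hj]
  refine ⟨(FirstOrder.Language.Term.var i).equal (FirstOrder.Language.Term.var j), ?_⟩
  ext v
  simp

end DefPred

theorem DefinableRel.app {r : M → M → Prop} (hr : DefinableRel L r) {f g : (Fin n → M) → M}
    (hf : IsCoord f) (hg : IsCoord g) : DefPred L fun v => r (f v) (g v) := by
  have h : DefPred L fun v : Fin 2 → M => r (v 0) (v 1) := hr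
  exact h.comp (f := ![f, g]) (by
    intro i
    fin_cases i
    exacts [hf, hg])

theorem definableRel_of {r : M → M → Prop} (h : DefPred L fun v : Fin 2 → M => r (v 0) (v 1)) :
    DefinableRel L r := h

variable (L) in
/-- The set `D` is definable without parameters. -/
def DefinableSet (D : Set M) : Prop :=
  (∅ : Set M).Definable₁ L D

theorem DefinableSet.mem {D : Set M} (hD : DefinableSet L D) {f : (Fin n → M) → M}
    (hf : IsCoord f) : DefPred L fun v => f v ∈ D := by
  have h : DefPred L fun v : Fin 1 → M => v 0 ∈ D := hD
  exact h.comp (f := ![f]) (by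
    intro i
    fin_cases i
    exact hf)

theorem definableSet_of {p : M → Prop} (h : DefPred L fun v : Fin 1 → M => p (v 0)) :
    DefinableSet L {x | p x} := h

theorem DefinableSet.inter {D D' : Set M} (h : DefinableSet L D) (h' : DefinableSet L D') :
    DefinableSet L (D ∩ D') :=
  Set.Definable.inter h h'

theorem DefinableSet.diff {D D' : Set M} (h : DefinableSet L D) (h' : DefinableSet L D') :
    DefinableSet L (D \ D') :=
  Set.Definable.sdiff h h'

theorem DefinableSet.compl {D : Set M} (h : DefinableSet L D) : DefinableSet L Dᶜ :=
  Set.Definable.compl h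

theorem definableSet_univ : DefinableSet L (Set.univ : Set M) :=
  Set.definable_univ

theorem definableSet_empty : DefinableSet L (∅ : Set M) :=
  Set.definable_empty

end Definability

/-! ### Finite unions of sets with a given property. -/

section Covers

variable {X : Type w}

/-- `A` is a finite union of sets with the property `P`. -/
inductive FinCover (P : Set X → Prop) : Set X → Prop
  | base {A} : P A → FinCover P A
  | union {A B} : FinCover P A → FinCover P B → FinCover P (A ∪ B)

theorem FinCover.bind {P Q : Set X → Prop} {A : Set X} (h : FinCover P A)
    (hPQ : ∀ D ⊆ A, P D → FinCover Q D) : FinCover Q A := by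
  induction h with
  | base h => exact hPQ _ subset_rfl h
  | union _ _ ih ih' =>
    exact (ih fun D hD => hPQ D (hD.trans Set.subset_union_left)).union
      (ih' fun D hD => hPQ D (hD.trans Set.subset_union_right))

theorem FinCover.inter {P Q R : Set X → Prop} {A B : Set X} (hA : FinCover P A)
    (hB : FinCover Q B) (hPQ : ∀ C D, P C → Q D → FinCover R (C ∩ D)) : FinCover R (A ∩ B) := by
  induction hA with
  | @base C hC =>
    induction hB with
    | base hD => exact hPQ _ _ hC hD
    | union _ _ ih ih' =>
      rw [Set.inter_union_distrib_left]
      exact ih.union ih'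
  | union _ _ ih ih' =>
    rw [Set.union_inter_distrib_right]
    exact ih.union ih'

/-- A property of all pieces of a finite union passes to the union. -/
theorem FinCover.of_union {P Q : Set X → Prop} {A : Set X} (h : FinCover P A)
    (hPQ : ∀ D, P D → Q D) (hQ : ∀ C D, Q C → Q D → Q (C ∪ D)) : Q A := by
  induction h with
  | base h => exact hPQ _ h
  | union _ _ ih ih' => exact hQ _ _ ih ih'

theorem FinCover.split {P : Set X → Prop} {A : Set X} (B : Set X) (h : FinCover P (A ∩ B))
    (h' : FinCover P (A \ B)) : FinCover P A := by
  rw [← Set.inter_union_sdiff A B]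
  exact h.union h'

end Covers

/-! ### Alternating chains and tame sets. -/

section Alternation

variable {X : Type w}

/-- There is a chain of length `m` in `K`, ending below `y`, which alternates between `P` and its
complement; the last element of the chain is in `P` if and only if `s = true`. -/
def alt (r : X → X → Prop) (K P : Set X) : Bool → ℕ → X → Prop
  | _, 0, _ => True
  | s, m + 1, y => ∃ u, u ∈ K ∧ (u = y ∨ r u y) ∧ (u ∈ P ↔ s = true) ∧ alt r K P (!s) m u

variable {r : X → X → Prop} {K K' P : Set X} {s : Bool} {m n : ℕ} {y z : X}

/-- The chain only has to end at or below `y`. Existence of a chain is therefore an up-closed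
condition on `y`, which is what later produces up-closed relations. -/
theorem alt.mono_right (hr : IsStrictTotalOrder X r) (h : alt r K P s m y)
    (hyz : y = z ∨ r y z) : alt r K P s m z := by
  cases m with
  | zero => trivial
  | succ m =>
    obtain ⟨u, hu, huy, hs, ha⟩ := h
    refine ⟨u, hu, ?_, hs, ha⟩
    rcases huy with rfl | huy
    · exact hyz
    · rcases hyz with rfl | hyz
      · exact Or.inr huy
      · exact Or.inr (hr.trans _ _ _ huy hyz)

theorem alt.mono_set (hK : K ⊆ K') (h : alt r K P s m y) : alt r K' P s m y := by
  induction m generalizing s y with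
  | zero => trivial
  | succ m ih =>
    obtain ⟨u, hu, huy, hs, ha⟩ := h
    exact ⟨u, hK hu, huy, hs, ih ha⟩

theorem alt.append (h : alt r K P s m y) (hr : IsStrictTotalOrder X r) (hz : z ∈ K)
    (hyz : y = z ∨ r y z) (hs : z ∈ P ↔ (!s) = true) : alt r K P (!s) (m + 1) z :=
  ⟨z, hz, Or.inl rfl, hs, by simpa using h.mono_right hr hyz⟩

/-- On `D`, membership in `A` is determined by a monotone function to `{0, …, n}`. -/
def TameOn (r : X → X → Prop) (D : Set X) (n : ℕ) (A : Set X) : Prop :=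
  ∃ f : X → ℕ, (∀ x, f x ≤ n) ∧
    ∀ x ∈ D, ∀ y ∈ D, r x y → f x ≤ f y ∧ (f x = f y → (x ∈ A ↔ y ∈ A))

theorem TameOn.mono_set {D D' A : Set X} (h : TameOn r D n A) (hD : D' ⊆ D) :
    TameOn r D' n A := by
  obtain ⟨f, hf, h⟩ := h
  exact ⟨f, hf, fun x hx y hy => h x (hD hx) y (hD hy)⟩

theorem TameOn.compl {D A : Set X} (h : TameOn r D n A) : TameOn r D n Aᶜ := by
  obtain ⟨f, hf, h⟩ := h
  exact ⟨f, hf, fun x hx y hy hxy => ⟨(h x hx y hy hxy).1, fun e =>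
    not_congr ((h x hx y hy hxy).2 e)⟩⟩

theorem TameOn.union {D D' A B : Set X} (hA : TameOn r D n A)
    (hB : TameOn r D' m B) : TameOn r (D ∩ D') (n + m) (A ∪ B) := by
  obtain ⟨f, hf, hA⟩ := hA
  obtain ⟨g, hg, hB⟩ := hB
  refine ⟨fun x => f x + g x, fun x => add_le_add (hf x) (hg x), fun x hx y hy hxy => ?_⟩
  obtain ⟨h1, h2⟩ := hA x hx.1 y hy.1 hxy
  obtain ⟨h3, h4⟩ := hB x hx.2 y hy.2 hxy
  refine ⟨add_le_add h1 h3, fun e => ?_⟩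
  exact or_congr (h2 (by dsimp only at e; omega)) (h4 (by dsimp only at e; omega))

theorem TameOn.of_const {D A : Set X} (h : ∀ x ∈ D, ∀ y ∈ D, x ∈ A ↔ y ∈ A) :
    TameOn r D 0 A :=
  ⟨fun _ => 0, fun _ => le_rfl, fun x hx y hy _ => ⟨le_rfl, fun _ => h x hx y hy⟩⟩

theorem TameOn.of_convex (hr : IsStrictTotalOrder X r) {D A : Set X} (h : IsConvex r A) :
    TameOn r D 2 A := by
  classical
  -- The three values stand for: before `A`, inside `A`, after `A`.
  refine ⟨fun x => if x ∈ A then 1 else if ∃ a ∈ A, r a x then 2 else 0, fun x => ?_,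
    fun x _ y _ hxy => ?_⟩
  · dsimp only
    split_ifs <;> omega
  · have h1 : x ∈ A → y ∉ A → ∃ a ∈ A, r a y := fun hx _ => ⟨x, hx, hxy⟩
    have h2 : (∃ a ∈ A, r a x) → ∃ a ∈ A, r a y := fun ⟨a, ha, hax⟩ =>
      ⟨a, ha, hr.trans _ _ _ hax hxy⟩
    have h3 : (∃ a ∈ A, r a x) → y ∈ A → x ∈ A := fun ⟨a, ha, hax⟩ hy => h a ha y hy x hax hxy
    dsimp only
    split_ifs <;> simp_all

/-- The monotone function must strictly increase at each change of membership, so its value at the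
end of a chain bounds the number of alternations. -/
theorem TameOn.exists_le_of_alt {D A : Set X} {f : X → ℕ}
    (h : ∀ x ∈ D, ∀ y ∈ D, r x y → f x ≤ f y ∧ (f x = f y → (x ∈ A ↔ y ∈ A))) (hK : K ⊆ D)
    (ha : alt r K A s (m + 1) y) : ∃ u ∈ K, (u ∈ A ↔ s = true) ∧ (u = y ∨ r u y) ∧ m ≤ f u := by
  induction m generalizing s y with
  | zero =>
    obtain ⟨u, hu, huy, hs, -⟩ := ha
    exact ⟨u, hu, hs, huy, Nat.zero_le _⟩
  | succ m ih =>
    obtain ⟨u, hu, huy, hs, ha⟩ := ha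
    obtain ⟨t, ht, hts, htu, hm⟩ := ih ha
    refine ⟨u, hu, hs, huy, ?_⟩
    rcases htu with rfl | htu
    · cases s <;> simp_all
    · obtain ⟨h1, h2⟩ := h t (hK ht) u (hK hu) htu
      have : f t ≠ f u := fun e => by
        have := h2 e
        cases s <;> simp_all
      omega

theorem TameOn.not_alt {D A : Set X} (h : TameOn r D n A) (hK : K ⊆ D) :
    ¬ alt r K A s (n + 2) y := fun ha => by
  obtain ⟨f, hf, h⟩ := h
  obtain ⟨u, -, -, -, hu⟩ := exists_le_of_alt h hK ha
  have := hf u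
  omega

/-- The length of the longest chain ending at or below a point serves as the monotone function. -/
theorem TameOn.of_not_alt (hr : IsStrictTotalOrder X r) {D A : Set X}
    (h : ∀ s y, ¬ alt r D A s (n + 1) y) : TameOn r D n A := by
  classical
  refine ⟨fun x => Nat.findGreatest (fun m => ∃ s, alt r D A s m x) n,
    fun x => Nat.findGreatest_le _, fun x hx y hy hxy => ?_⟩
  have spec : ∀ x, ∃ s, alt r D A s (Nat.findGreatest (fun m => ∃ s, alt r D A s m x) n) x :=
    fun x => Nat.findGreatest_spec (P := fun m => ∃ s, alt r D A s m x) (Nat.zero_le n)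
      ⟨true, trivial⟩
  have max : ∀ x s m, alt r D A s m x → m ≤ n →
      m ≤ Nat.findGreatest (fun m => ∃ s, alt r D A s m x) n := fun x s m ha hm =>
    Nat.le_findGreatest hm ⟨s, ha⟩
  -- A longest chain ending at or below `z` has to end in the colour of `z`, since otherwise `z`
  -- could be appended to it.
  have key : ∀ z ∈ D, ∀ s, alt r D A s (Nat.findGreatest (fun m => ∃ s, alt r D A s m z) n) z →
      (z ∈ A ↔ s = true) := by
    intro z hz s hs
    by_contra hne
    have h1 := hs.append hr hz (Or.inl rfl) (by cases s <;> simp_all)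
    rcases (Nat.findGreatest_le (P := fun m => ∃ s, alt r D A s m z) n).lt_or_eq with hlt | heq
    · have := max z _ _ h1 hlt
      omega
    · rw [heq] at h1
      exact h _ _ h1
  obtain ⟨s, hs⟩ := spec x
  have hs' := hs.mono_right hr (Or.inr hxy)
  refine ⟨max y s _ hs' (Nat.findGreatest_le _), fun e => ?_⟩
  rw [key x hx s hs, key y hy s]
  simp only at e
  rwa [e] at hs'

end Alternation

/-! ### Definability of alternation. -/

section AltDefinable

variable {L : FirstOrder.Language.{u, v}} {M : Type w} [L.Structure M]

theorem definable_alt {r : M → M → Prop} (hr : DefinableRel L r) {K P : M → Set M}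
    (hK : DefinableRel L fun a u => u ∈ K a) (hP : DefinableRel L fun a u => u ∈ P a) (s : Bool)
    (m : ℕ) : DefinableRel L fun a y => alt r (K a) (P a) s m y := by
  induction m generalizing s with
  | zero => exact DefPred.const True
  | succ m ih =>
    refine definableRel_of (DefPred.ex ?_)
    have ih := ih (!s)
    apply_rules [DefPred.and, DefPred.or, DefPred.iff, DefPred.eq, DefPred.const, hr.app, ih.app] <;>
    first
      | exact ⟨_, fun _ => rfl⟩
      | exact hK.app ⟨_, fun _ => rfl⟩ ⟨_, fun _ => rfl⟩
      | exact hP.app ⟨_, fun _ => rfl⟩ ⟨_, fun _ => rfl⟩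

end AltDefinable

/-! ### Reversing convex classes; its effect on orders, convexity and tameness. -/

section FlipOrder

variable {X : Type w} {r E : X → X → Prop}

theorem flipOrder_of_rel {x y : X} (h : E x y) : flipOrder r E x y ↔ r y x := by
  simp [flipOrder, h]

theorem flipOrder_of_not_rel {x y : X} (h : ¬ E x y) : flipOrder r E x y ↔ r x y := by
  simp [flipOrder, h]

theorem IsConvexEquiv.rel_of_rel (hE : IsConvexEquiv r E) (hr : IsStrictTotalOrder X r)
    {x y x' y' : X} (hxy : ¬ E x y) (h : r x y) (hx : E x x') (hy : E y y') : r x' y' := by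
  obtain ⟨hE, hc⟩ := hE
  have tri : ∀ {a b}, ¬ E a b → ¬ r b a → r a b := fun {a b} h1 h2 => by
    by_contra h
    exact h1 (hr.trichotomous a b h h2 ▸ hE.refl a)
  have hx'y : ¬ E x' y := fun h => hxy (hE.trans hx h)
  have hx'y' : ¬ E x' y' := fun h => hx'y (hE.trans h (hE.symm hy))
  have h1 : r x' y := tri hx'y fun h' => hxy (hc x x (hE.refl x) x' hx y h h')
  exact tri hx'y' fun h' =>
    hx'y (hE.symm (hc y y' hy y (hE.refl y) x' h' h1))

theorem isStrictTotalOrder_flipOrder (hr : IsStrictTotalOrder X r) (hE : IsConvexEquiv r E) :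
    IsStrictTotalOrder X (flipOrder r E) := by
  obtain ⟨hE, hc⟩ := hE
  have hconv : ∀ {a b c}, E a b → r a c → r c b → E a c := fun {a b c} h h1 h2 =>
    hc a a (hE.refl a) b h c h1 h2
  have tri : ∀ a b, r a b ∨ a = b ∨ r b a := fun a b => by
    by_contra! h
    exact h.2.1 (hr.trichotomous a b h.1 h.2.2)
  refine { trichotomous := ?_, irrefl := ?_, trans := ?_ }
  · intro a b h1 h2
    by_cases h : E a b
    · rw [flipOrder_of_rel h] at h1
      rw [flipOrder_of_rel (hE.symm h)] at h2
      exact hr.trichotomous a b h2 h1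
    · rw [flipOrder_of_not_rel h] at h1
      rw [flipOrder_of_not_rel fun h' => h (hE.symm h')] at h2
      exact hr.trichotomous a b h1 h2
  · intro a h
    rw [flipOrder_of_rel (hE.refl a)] at h
    exact hr.irrefl a h
  · intro a b c h1 h2
    by_cases hab : E a b <;> by_cases hbc : E b c
    · rw [flipOrder_of_rel hab] at h1
      rw [flipOrder_of_rel hbc] at h2
      rw [flipOrder_of_rel (hE.trans hab hbc)]
      exact hr.trans _ _ _ h2 h1
    · have hac : ¬ E a c := fun h => hbc (hE.trans (hE.symm hab) h)
      rw [flipOrder_of_rel hab] at h1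
      rw [flipOrder_of_not_rel hbc] at h2
      rw [flipOrder_of_not_rel hac]
      rcases tri a c with h | rfl | h
      · exact h
      · exact absurd (hE.refl _) hac
      · exact absurd (hconv (hE.symm hab) h2 h) hbc
    · have hac : ¬ E a c := fun h => hab (hE.trans h (hE.symm hbc))
      rw [flipOrder_of_not_rel hab] at h1
      rw [flipOrder_of_rel hbc] at h2
      rw [flipOrder_of_not_rel hac]
      rcases tri a c with h | rfl | h
      · exact h
      · exact absurd (hE.refl _) hac
      · exact absurd (hE.symm (hE.trans hbc (hconv (hE.symm hbc) h h1))) hab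
    · rw [flipOrder_of_not_rel hab] at h1
      rw [flipOrder_of_not_rel hbc] at h2
      have hac : ¬ E a c := fun h => hab (hconv h h1 h2)
      rw [flipOrder_of_not_rel hac]
      exact hr.trans _ _ _ h1 h2

theorem isStrictTotalOrder_seqOrder {Es : List (X → X → Prop)} (hr : IsStrictTotalOrder X r)
    (h : IsAdmissible r Es) : IsStrictTotalOrder X (seqOrder r Es) := by
  induction Es generalizing r with
  | nil => exact hr
  | cons E Es ih => exact ih (isStrictTotalOrder_flipOrder hr h.1) h.2

/-- Two points of an `F`-class lie in one `E`-class, so a point between them in the new order is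
between them in the old one, possibly with the ends exchanged. -/
theorem IsConvexEquiv.flipOrder {F : X → X → Prop} (hE : IsConvexEquiv r E)
    (hF : IsConvexEquiv r F) (h : ∀ x y, F x y → E x y) :
    IsConvexEquiv (flipOrder r E) F := by
  refine ⟨hF.1, fun a p hp q hq c h1 h2 => ?_⟩
  have hpq : E p q := h _ _ (hF.1.trans (hF.1.symm hp) hq)
  by_cases hpc : E p c
  · rw [flipOrder_of_rel hpc] at h1
    rw [flipOrder_of_rel (hE.1.trans (hE.1.symm hpc) hpq)] at h2
    exact hF.2 a q hq p hp c h2 h1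
  · rw [flipOrder_of_not_rel hpc] at h1
    rw [flipOrder_of_not_rel fun h' => hpc (hE.1.trans hpq (hE.1.symm h'))] at h2
    exact hF.2 a p hp q hq c h1 h2

theorem isAdmissible_of_isDecreasing {Es : List (X → X → Prop)}
    (h : ∀ E ∈ Es, IsConvexEquiv r E) (hd : IsDecreasing Es) : IsAdmissible r Es := by
  induction Es generalizing r with
  | nil => trivial
  | cons E Es ih =>
    obtain ⟨h1, h2⟩ := List.pairwise_cons.mp hd
    rw [List.forall_mem_cons] at h
    exact ⟨h.1, ih (fun F hF => h.1.flipOrder (h.2 F hF) (h1 F hF)) h2⟩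

/-- Each reversal decides a pair from that pair alone, so only the values of the base order on `x`,
`y` matter. -/
theorem seqOrder_congr {r r' : X → X → Prop} {Es : List (X → X → Prop)}
    (hE : ∀ E ∈ Es, Equivalence E) {x y : X} (h1 : r x y ↔ r' x y) (h2 : r y x ↔ r' y x) :
    seqOrder r Es x y ↔ seqOrder r' Es x y := by
  induction Es generalizing r r' with
  | nil => exact h1
  | cons E Es ih =>
    rw [List.forall_mem_cons] at hE
    have hs : E x y ↔ E y x := ⟨hE.1.symm, hE.1.symm⟩
    exact ih hE.2 (by simp only [flipOrder, h1, h2]) (by simp only [flipOrder, h1, h2])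

theorem seqOrder_of_not_rel {r : X → X → Prop} {Es : List (X → X → Prop)} {x y : X}
    (h : ∀ E ∈ Es, ¬ E x y) : seqOrder r Es x y ↔ r x y := by
  induction Es generalizing r with
  | nil => exact Iff.rfl
  | cons E Es ih =>
    rw [List.forall_mem_cons] at h
    exact (ih h.2).trans (flipOrder_of_not_rel h.1)

/-- Each threshold `i ≤ n` of the old function cuts `D` into a lower and an upper part, and at most
one `E`-class straddles the cut. After reversal that class shows its upper part first, so four
levels suffice per threshold; the new function is the sum of these levels. -/
theorem TameOn.flipOrder {D A : Set X} {n : ℕ} (hr : IsStrictTotalOrder X r) (hE : IsConvexEquiv r E)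
    (h : TameOn r D n A) : TameOn (flipOrder r E) D ((n + 1) * 3) A := by
  classical
  obtain ⟨f, hf, h⟩ := h
  -- Levels: 0 for classes below the cut, 1 and 2 for the upper and lower parts of a straddling
  -- class, 3 for classes above the cut.
  let g : ℕ → X → ℕ := fun i x =>
    if ∀ y ∈ D, E x y → f y < i then 0 else if ∀ y ∈ D, E x y → i ≤ f y then 3 else
      if i ≤ f x then 1 else 2
  have hg : ∀ i x, g i x ≤ 3 := fun i x => by
    simp only [g]
    split_ifs <;> omega
  have key : ∀ i, ∀ x ∈ D, ∀ y ∈ D, WQOM.flipOrder r E x y →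
      g i x ≤ g i y ∧ (g i x = g i y → (i ≤ f x ↔ i ≤ f y)) := by
    intro i x hx y hy hxy
    by_cases hE' : E x y
    · rw [flipOrder_of_rel hE'] at hxy
      have hm := (h y hy x hx hxy).1
      have e1 : ∀ z, E x z ↔ E y z := fun z =>
        ⟨hE.1.trans (hE.1.symm hE'), hE.1.trans hE'⟩
      have h1 : (∀ z ∈ D, E y z → f z < i) → f x < i ∧ f y < i := fun h =>
        ⟨h x hx (hE.1.symm hE'), h y hy (hE.1.refl y)⟩
      have h2 : (∀ z ∈ D, E y z → i ≤ f z) → i ≤ f x ∧ i ≤ f y := fun h =>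
        ⟨h x hx (hE.1.symm hE'), h y hy (hE.1.refl y)⟩
      simp only [g, e1]
      by_cases c1 : ∀ z ∈ D, E y z → f z < i
      · have := h1 c1
        simp only [if_pos c1]
        omega
      · by_cases c2 : ∀ z ∈ D, E y z → i ≤ f z
        · have := h2 c2
          simp only [if_neg c1, if_pos c2]
          omega
        · simp only [if_neg c1, if_neg c2]
          split_ifs <;> omega
    · rw [flipOrder_of_not_rel hE'] at hxy
      have hle : ∀ x' ∈ D, ∀ y' ∈ D, E x x' → E y y' → f x' ≤ f y' :=
        fun x' hx' y' hy' h1 h2 => (h x' hx' y' hy' (hE.rel_of_rel hr hE' hxy h1 h2)).1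
      have hxy' := hle x hx y hy (hE.1.refl x) (hE.1.refl y)
      have a1 : (∀ z ∈ D, E y z → f z < i) → ∀ z ∈ D, E x z → f z < i := fun h z hz hxz =>
        (hle z hz y hy hxz (hE.1.refl y)).trans_lt (h y hy (hE.1.refl y))
      have a2 : (∀ z ∈ D, E x z → i ≤ f z) → ∀ z ∈ D, E y z → i ≤ f z := fun h z hz hyz =>
        (h x hx (hE.1.refl x)).trans (hle x hx z hz (hE.1.refl x) hyz)
      have a3 : (¬ ∀ z ∈ D, E x z → f z < i) → ∀ z ∈ D, E y z → i ≤ f z := fun h z hz hyz => by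
        push Not at h
        obtain ⟨t, ht, hxt, hit⟩ := h
        exact hit.trans (hle t ht z hz hxt hyz)
      have b1 : (∀ z ∈ D, E x z → f z < i) → f x < i := fun h => h x hx (hE.1.refl x)
      have b2 : (∀ z ∈ D, E x z → i ≤ f z) → i ≤ f x := fun h => h x hx (hE.1.refl x)
      have b3 : (∀ z ∈ D, E y z → f z < i) → f y < i := fun h => h y hy (hE.1.refl y)
      have b4 : (∀ z ∈ D, E y z → i ≤ f z) → i ≤ f y := fun h => h y hy (hE.1.refl y)
      simp only [g]
      by_cases c1 : ∀ z ∈ D, E x z → f z < i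
      · have := b1 c1
        by_cases c3 : ∀ z ∈ D, E y z → f z < i
        · have := b3 c3
          rw [if_pos c1, if_pos c3]
          omega
        · rw [if_pos c1, if_neg c3]
          refine ⟨Nat.zero_le _, fun e => ?_⟩
          split_ifs at e
      · have c3 : ¬ ∀ z ∈ D, E y z → f z < i := fun h => c1 (a1 h)
        have c4 := a3 c1
        have := b4 c4
        rw [if_neg c1, if_neg c3, if_pos c4]
        by_cases c2 : ∀ z ∈ D, E x z → i ≤ f z
        · have := b2 c2
          rw [if_pos c2]
          omega
        · rw [if_neg c2]
          split_ifs <;> omega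
  -- Each `g i` is monotone, so equal sums force equal summands; these determine which thresholds
  -- lie below `f x`, hence `f x` itself.
  have hsum : ∀ x ∈ D, ∀ y ∈ D, WQOM.flipOrder r E x y →
      ∑ i ∈ Finset.range (n + 1), g i x = ∑ i ∈ Finset.range (n + 1), g i y → f x = f y := by
    intro x hx y hy hxy e
    have := (Finset.sum_eq_sum_iff_of_le fun i _ => (key i x hx y hy hxy).1).mp e
    have hi : ∀ i ≤ n, (i ≤ f x ↔ i ≤ f y) := fun i hi =>
      (key i x hx y hy hxy).2 (this i (by simpa [Nat.lt_succ_iff] using hi))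
    exact le_antisymm ((hi _ (hf x)).mp le_rfl) ((hi _ (hf y)).mpr le_rfl)
  refine ⟨fun x => ∑ i ∈ Finset.range (n + 1), g i x, fun x => ?_, fun x hx y hy hxy =>
    ⟨Finset.sum_le_sum fun i _ => (key i x hx y hy hxy).1, fun e => ?_⟩⟩
  · simpa using Finset.sum_le_card_nsmul (Finset.range (n + 1)) (fun i => g i x) 3
      fun i _ => hg i x
  · have e' := hsum x hx y hy hxy e
    by_cases hE' : E x y
    · rw [flipOrder_of_rel hE'] at hxy
      exact ((h y hy x hx hxy).2 e'.symm).symm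
    · rw [flipOrder_of_not_rel hE'] at hxy
      exact (h x hx y hy hxy).2 e'

/-- The new bound is chosen before `D` and `A`; this keeps tameness uniform over a family of sets.
-/
theorem TameOn.seqOrder {Es : List (X → X → Prop)} (hr : IsStrictTotalOrder X r)
    (h : IsAdmissible r Es) {n : ℕ} :
    ∃ m, ∀ D A, TameOn r D n A → TameOn (seqOrder r Es) D m A := by
  induction Es generalizing r n with
  | nil => exact ⟨n, fun _ _ h => h⟩
  | cons E Es ih =>
    obtain ⟨m, hm⟩ := ih (isStrictTotalOrder_flipOrder hr h.1) h.2 (n := (n + 1) * 3)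
    exact ⟨m, fun D A hA => hm D A (hA.flipOrder hr h.1)⟩

end FlipOrder

/-! ### Definability of the reversed orders. -/

section FlipDefinable

variable {L : FirstOrder.Language.{u, v}} {M : Type w} [L.Structure M]

theorem DefinableRel.flipOrder {r E : M → M → Prop} (hr : DefinableRel L r)
    (hE : DefinableRel L E) : DefinableRel L (flipOrder r E) := by
  refine definableRel_of (r := WQOM.flipOrder r E) (DefPred.or ?_ ?_)
  all_goals
    apply_rules [DefPred.and, DefPred.not, hr.app, hE.app] <;> exact ⟨_, fun _ => rfl⟩

theorem DefinableRel.seqOrder {r : M → M → Prop} {Es : List (M → M → Prop)}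
    (hr : DefinableRel L r) (hE : ∀ E ∈ Es, DefinableRel L E) :
    DefinableRel L (seqOrder r Es) := by
  induction Es generalizing r with
  | nil => exact hr
  | cons E Es ih =>
    rw [List.forall_mem_cons] at hE
    exact ih (hr.flipOrder hE.1) hE.2

end FlipDefinable

/-! ### Expressing one order by successive reversals of another. -/

section Resolution

variable {L : FirstOrder.Language.{u, v}} {M : Type w} [L.Structure M]

variable (L) in
/-- `D` is definable and on each `E`-class of `D`, the order `q` is of the form `r_F` for a
decreasing sequence `F` of definable `r`-convex equivalence relations contained in `E`. -/
def ResolvedOn (r q E : M → M → Prop) (D : Set M) : Prop :=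
  DefinableSet L D ∧ ∃ Es : List (M → M → Prop),
    (∀ F ∈ Es, DefinableRel L F ∧ IsConvexEquiv r F ∧ ∀ x y, F x y → E x y) ∧ IsDecreasing Es ∧
      ∀ x ∈ D, ∀ y ∈ D, E x y → (q x y ↔ seqOrder r Es x y)

variable {r q E F : M → M → Prop} {D : Set M} {s : Bool}

theorem rel_iff_not_rel (hr : IsStrictTotalOrder M r) {x y : M} (hne : x ≠ y) :
    r y x ↔ ¬ r x y :=
  ⟨fun h h' => hr.irrefl x (hr.trans _ _ _ h' h), fun h => by
    by_contra h'
    exact hne (hr.trichotomous _ _ h h')⟩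

/-- Resolution inside the classes of `F` extends to the classes of a coarser `E` if the pairs which
are related by `E` but not by `F` are all ordered by `q` as by `r`, or all in reverse. -/
theorem ResolvedOn.extend (hr : IsStrictTotalOrder M r) (hq : IsStrictTotalOrder M q)
    (hE : IsConvexEquiv r E) (hEd : DefinableRel L E) (hF : IsConvexEquiv r F)
    (hFd : DefinableRel L F) (hFE : ∀ x y, F x y → E x y) (h : ResolvedOn L r q F D)
    (hs : ∀ x ∈ D, ∀ y ∈ D, r x y → E x y → ¬ F x y → (q y x ↔ s = true)) :
    ResolvedOn L r q E D := by
  obtain ⟨hD, Es, hEs, hdec, hres⟩ := h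
  have hs' : ∀ x ∈ D, ∀ y ∈ D, E x y → ¬ F x y →
      (q x y ↔ if s = true then r y x else r x y) := by
    intro x hx y hy hxy hF'
    have hne : x ≠ y := fun h => hF' (h ▸ hF.1.refl x)
    by_cases hrxy : r x y
    · have := hs x hx y hy hrxy hxy hF'
      have h1 := rel_iff_not_rel hq hne
      have h2 := rel_iff_not_rel hr hne
      cases s <;> simp_all
    · have hryx := (rel_iff_not_rel hr hne).mpr hrxy
      have := hs y hy x hx hryx (hE.1.symm hxy) fun h => hF' (hF.1.symm h)
      cases s <;> simp_all
  cases s with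
  | false =>
    refine ⟨hD, Es, fun G hG => ⟨(hEs G hG).1, (hEs G hG).2.1, fun x y h =>
      hFE _ _ ((hEs G hG).2.2 x y h)⟩, hdec, fun x hx y hy hxy => ?_⟩
    by_cases hF' : F x y
    · exact hres x hx y hy hF'
    · rw [seqOrder_of_not_rel fun G hG h => hF' ((hEs G hG).2.2 x y h)]
      simpa using hs' x hx y hy hxy hF'
  | true =>
    -- Reversing `E` turns round all pairs of the class; reversing `F` next restores the pairs
    -- inside `F`-classes, where `Es` then does its work.
    refine ⟨hD, E :: F :: Es, ?_, ?_, fun x hx y hy hxy => ?_⟩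
    · rw [List.forall_mem_cons, List.forall_mem_cons]
      exact ⟨⟨hEd, hE, fun _ _ h => h⟩, ⟨hFd, hF, hFE⟩, fun G hG => ⟨(hEs G hG).1, (hEs G hG).2.1,
        fun x y h => hFE _ _ ((hEs G hG).2.2 x y h)⟩⟩
    · refine List.pairwise_cons.mpr ⟨?_, List.pairwise_cons.mpr
        ⟨fun G hG => (hEs G hG).2.2, hdec⟩⟩
      rw [List.forall_mem_cons]
      exact ⟨hFE, fun G hG x y h => hFE _ _ ((hEs G hG).2.2 x y h)⟩
    · by_cases hF' : F x y
      · rw [hres x hx y hy hF']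
        refine seqOrder_congr (fun G hG => (hEs G hG).2.1.1) ?_ ?_
        · rw [flipOrder_of_rel hF', flipOrder_of_rel (hE.1.symm hxy)]
        · rw [flipOrder_of_rel (hF.1.symm hF'), flipOrder_of_rel hxy]
      · have h1 := seqOrder_of_not_rel (r := flipOrder (flipOrder r E) F)
          fun G hG h => hF' ((hEs G hG).2.2 x y h)
        rw [hs' x hx y hy hxy hF', seqOrder, seqOrder, h1, flipOrder_of_not_rel hF',
          flipOrder_of_rel hxy, if_pos rfl]

theorem resolvedOn_empty (r E : M → M → Prop) : ResolvedOn L r q E ∅ :=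
  ⟨definableSet_empty, [], by simp, List.Pairwise.nil, by simp⟩

end Resolution

/-! ### Crossings, ties and their convex hulls. -/

section Decomposition

variable {L : FirstOrder.Language.{u, v}} {M : Type w} [L.Structure M] [LinearOrder M]

/-- The elements of `D` above `a` in the `E`-class of `a`. -/
def upper (D : Set M) (E : M → M → Prop) (a : M) : Set M :=
  {u | u ∈ D ∧ a < u ∧ E a u}

/-- The triples `x < a < z` in one `E`-class for which `z` has colour `!s` with respect to `x`,
while all elements of `D` above `z` have colour `s` with respect to `a`. -/
def crossing (q E : M → M → Prop) (D : Set M) (s : Bool) (x a z : M) : Prop :=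
  x < a ∧ a < z ∧ E x z ∧ (q z x ↔ (!s) = true) ∧
    ∀ z', z' ∈ D → (z = z' ∨ z < z') → E a z' → (q z' a ↔ s = true)

/-- The elements of `A` from which `k` successive crossings in `A` start. -/
def crossingSet (q E : M → M → Prop) (D : Set M) (s : Bool) (A : Set M) : ℕ → Set M
  | 0 => A
  | k + 1 => {x | x ∈ crossingSet q E D s A k ∧ ∃ a z, a ∈ crossingSet q E D s A k ∧
      z ∈ crossingSet q E D s A k ∧ crossing q E D s x a z}

/-- Some element of `D` above `y` in the `E`-class of `x` has colour `!s` with respect to `x`. -/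
def tied (q E : M → M → Prop) (D : Set M) (s : Bool) (x y : M) : Prop :=
  x < y ∧ E x y ∧ ∃ z, z ∈ D ∧ (y = z ∨ y < z) ∧ E x z ∧ (q z x ↔ (!s) = true)

/-- Both `u` and `v` are between two tied elements of `A`, or `u = v`. -/
def hull (A : Set M) (N : M → M → Prop) (u v : M) : Prop :=
  u = v ∨ ∃ x y, x ∈ A ∧ y ∈ A ∧ N x y ∧ (x = u ∨ x < u) ∧ (u = y ∨ u < y) ∧
    (x = v ∨ x < v) ∧ (v = y ∨ v < y)

section Definability

variable {q E : M → M → Prop} {D A : Set M}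

theorem definable_upper (hr : DefinableRel L fun x y : M => x < y) (hD : DefinableSet L D)
    (hE : DefinableRel L E) : DefinableRel L fun a u => u ∈ upper D E a := by
  refine definableRel_of (r := fun a u => u ∈ D ∧ a < u ∧ E a u) ?_
  apply_rules [DefPred.and, hr.app, hE.app, hD.mem]
  exact ⟨_, fun _ => rfl⟩

theorem definable_crossingSet (hr : DefinableRel L fun x y : M => x < y)
    (hq : DefinableRel L q) (hE : DefinableRel L E) (hD : DefinableSet L D) (s : Bool)
    (hA : DefinableSet L A) (k : ℕ) : DefinableSet L (crossingSet q E D s A k) := by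
  induction k with
  | zero => exact hA
  | succ k ih =>
    refine definableSet_of (DefPred.and (ih.mem ⟨_, fun _ => rfl⟩) (DefPred.ex (DefPred.ex ?_)))
    unfold crossing
    apply_rules [DefPred.and, DefPred.or, DefPred.iff, DefPred.imp, DefPred.all, DefPred.eq,
      DefPred.const, hr.app, hE.app, hq.app, ih.mem, hD.mem] <;> exact ⟨_, fun _ => rfl⟩

theorem definable_tied (hr : DefinableRel L fun x y : M => x < y)
    (hq : DefinableRel L q) (hE : DefinableRel L E) (hD : DefinableSet L D) (s : Bool) :
    DefinableRel L (tied q E D s) := by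
  refine definableRel_of (r := tied q E D s) ?_
  unfold tied
  apply_rules [DefPred.and, DefPred.or, DefPred.iff, DefPred.imp, DefPred.ex, DefPred.eq,
    DefPred.const, hr.app, hE.app, hq.app, hD.mem] <;> exact ⟨_, fun _ => rfl⟩

theorem definable_hull (hr : DefinableRel L fun x y : M => x < y) {N : M → M → Prop}
    (hN : DefinableRel L N) (hA : DefinableSet L A) : DefinableRel L (hull A N) := by
  refine definableRel_of (r := hull A N) ?_
  unfold hull
  apply_rules [DefPred.and, DefPred.or, DefPred.ex, DefPred.eq, hr.app, hN.app, hA.mem] <;>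
    exact ⟨_, fun _ => rfl⟩

end Definability

/-- Both "`q` reverses the pair" and "`q` keeps the pair" are transitive along the order, because
`q` is a linear order. -/
theorem colour_trans {q : M → M → Prop} (hq : IsStrictTotalOrder M q) {s : Bool} {x y z : M}
    (hxy : x < y) (hyz : y < z) (h1 : q y x ↔ s = true) (h2 : q z y ↔ s = true) :
    q z x ↔ s = true := by
  cases s with
  | true => exact iff_of_true (hq.trans _ _ _ (h2.2 rfl) (h1.2 rfl)) rfl
  | false =>
    have h3 : ¬ q y x := by simpa using h1
    have h4 : ¬ q z y := by simpa using h2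
    rw [← rel_iff_not_rel hq hxy.ne'] at h3
    rw [← rel_iff_not_rel hq hyz.ne'] at h4
    refine iff_of_false ?_ (by simp)
    rw [← rel_iff_not_rel hq (hxy.trans hyz).ne']
    exact hq.trans _ _ _ h3 h4

theorem IsConvexEquiv.between {E : M → M → Prop} (hE : IsConvexEquiv (· < ·) E) {x y z : M}
    (hxz : E x z) (hxy : x ≤ y) (hyz : y ≤ z) : E x y ∧ E y z := by
  have : E x y := by
    rcases hxy.eq_or_lt with rfl | hxy
    · exact hE.1.refl _
    rcases hyz.eq_or_lt with rfl | hyz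
    · exact hxz
    exact hE.2 x x (hE.1.refl x) z hxz y hxy hyz
  exact ⟨this, hE.1.trans (hE.1.symm this) hxz⟩

/-- If `N` is transitive and inherited by subintervals on `A`, its hull is a convex
equivalence relation. -/
theorem isConvexEquiv_hull {A : Set M} {N : M → M → Prop}
    (hleft : ∀ x ∈ A, ∀ y ∈ A, ∀ z ∈ A, x < y → y < z → N x z → N x y)
    (htrans : ∀ x ∈ A, ∀ y ∈ A, ∀ z ∈ A, x < y → y < z → N x y → N y z → N x z) :
    IsConvexEquiv (· < ·) (hull A N) := by
  have hN : ∀ x ∈ A, ∀ y ∈ A, ∀ x' ∈ A, ∀ y' ∈ A, N x y → N x' y' → x ≤ x' → x' ≤ y → y < y' →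
      x < x' → x' < y → N x y' := fun x hx y hy x' hx' y' hy' h h' h1 h2 h3 h4 h5 =>
    htrans x hx x' hx' y' hy' h4 (h5.trans h3) (hleft x hx x' hx' y hy h4 h5 h) h'
  have hle : ∀ a b : M, (a = b ∨ a < b) ↔ a ≤ b := fun a b => le_iff_eq_or_lt.symm
  have merge : ∀ {u v w : M} {x y x' y' : M}, x ∈ A → y ∈ A → x' ∈ A → y' ∈ A → N x y → N x' y' →
      x ≤ u → u ≤ y → x ≤ v → v ≤ y → x' ≤ v → v ≤ y' → x' ≤ w → w ≤ y' → x ≤ x' →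
      ∃ a b, a ∈ A ∧ b ∈ A ∧ N a b ∧ a ≤ u ∧ u ≤ b ∧ a ≤ w ∧ w ≤ b := by
    intro u v w x y x' y' hx hy hx' hy' h h' xu uy xv vy xv' vy' xw wy hxx
    rcases le_or_gt y' y with hyy | hyy
    · exact ⟨x, y, hx, hy, h, xu, uy, hxx.trans xw, wy.trans hyy⟩
    refine ⟨x, y', hx, hy', ?_, xu, uy.trans hyy.le, hxx.trans xw, wy⟩
    rcases hxx.eq_or_lt with rfl | hxx
    · exact h'
    rcases (xv'.trans vy).eq_or_lt with rfl | hxy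
    · exact htrans x hx x' hx' y' hy' hxx hyy h h'
    · exact hN x hx y hy x' hx' y' hy' h h' hxx.le hxy.le hyy hxx hxy
  have hdef : hull A N = fun u v =>
      u = v ∨ ∃ x y, x ∈ A ∧ y ∈ A ∧ N x y ∧ x ≤ u ∧ u ≤ y ∧ x ≤ v ∧ v ≤ y := by
    ext u v
    simp only [hull, hle]
  rw [hdef]
  have htr : ∀ {u v w : M}, (u = v ∨ ∃ x y, x ∈ A ∧ y ∈ A ∧ N x y ∧ x ≤ u ∧ u ≤ y ∧ x ≤ v ∧ v ≤ y) →
      (v = w ∨ ∃ x y, x ∈ A ∧ y ∈ A ∧ N x y ∧ x ≤ v ∧ v ≤ y ∧ x ≤ w ∧ w ≤ y) →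
      (u = w ∨ ∃ x y, x ∈ A ∧ y ∈ A ∧ N x y ∧ x ≤ u ∧ u ≤ y ∧ x ≤ w ∧ w ≤ y) := by
    rintro u v w (rfl | ⟨x, y, hx, hy, h, h1, h2, h3, h4⟩) h'
    · exact h'
    rcases h' with rfl | ⟨x', y', hx', hy', h', h1', h2', h3', h4'⟩
    · exact Or.inr ⟨x, y, hx, hy, h, h1, h2, h3, h4⟩
    refine Or.inr ?_
    rcases le_total x x' with hxx | hxx
    · exact merge hx hy hx' hy' h h' h1 h2 h3 h4 h1' h2' h3' h4' hxx
    · obtain ⟨a, b, ha, hb, hab, k1, k2, k3, k4⟩ :=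
        merge hx' hy' hx hy h' h h3' h4' h1' h2' h3 h4 h1 h2 hxx
      exact ⟨a, b, ha, hb, hab, k3, k4, k1, k2⟩
  have hsymm : ∀ {u v : M},
      (u = v ∨ ∃ x y, x ∈ A ∧ y ∈ A ∧ N x y ∧ x ≤ u ∧ u ≤ y ∧ x ≤ v ∧ v ≤ y) →
      (v = u ∨ ∃ x y, x ∈ A ∧ y ∈ A ∧ N x y ∧ x ≤ v ∧ v ≤ y ∧ x ≤ u ∧ u ≤ y) := by
    rintro u v (rfl | ⟨x, y, hx, hy, h, h1, h2, h3, h4⟩)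
    · exact Or.inl rfl
    · exact Or.inr ⟨x, y, hx, hy, h, h3, h4, h1, h2⟩
  refine ⟨⟨fun _ => Or.inl rfl, hsymm, htr⟩, fun a p hp t ht c h1 h2 => ?_⟩
  refine htr hp ?_
  rcases htr (hsymm hp) ht with rfl | ⟨x, y, hx, hy, h, h3, h4, h5, h6⟩
  · exact absurd h2 h1.asymm
  · exact Or.inr ⟨x, y, hx, hy, h, h3, h4, h3.trans h1.le, h2.le.trans h6⟩

theorem crossingSet_subset {q E : M → M → Prop} {D A : Set M} {s : Bool} (k : ℕ) :
    crossingSet q E D s A k ⊆ A := by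
  induction k with
  | zero => exact subset_rfl
  | succ k ih => exact fun x hx => ih hx.1

theorem crossingSet_succ_subset {q E : M → M → Prop} {D A : Set M} {s : Bool} (k : ℕ) :
    crossingSet q E D s A (k + 1) ⊆ crossingSet q E D s A k := fun _ hx => hx.1

/-- Successive crossings produce alternations of an initial segment. -/
theorem exists_of_mem_crossingSet {q E : M → M → Prop} (hq : IsStrictTotalOrder M q)
    (hE : IsConvexEquiv (· < ·) E) {D D₀ A : Set M} {s : Bool} (hD : D ⊆ D₀) (hA : A ⊆ D) {k : ℕ}
    {x : M} (hx : x ∈ crossingSet q E D s A k) :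
    ∃ z ∈ D, (x = z ∨ x < z ∧ E x z ∧ (q z x ↔ (!s) = true)) ∧ ∀ f : M → ℕ,
      (∀ x ∈ D₀, ∀ y ∈ D₀, x < y → f x ≤ f y ∧ (f x = f y → (q x z ↔ q y z))) →
        f x + k ≤ f z := by
  induction k generalizing x with
  | zero => exact ⟨x, hA hx, Or.inl rfl, fun _ _ => le_rfl⟩
  | succ k ih =>
    obtain ⟨hx, a, y, ha, hy, hxa, hay, hExy, hc, hall⟩ := hx
    obtain ⟨z, hz, hyz, hf⟩ := ih hy
    have hxy := hxa.trans hay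
    have hle : y = z ∨ y < z := hyz.imp_right And.left
    have hEyz : E y z := by
      rcases hyz with rfl | h
      exacts [hE.1.refl _, h.2.1]
    have hxz : x < z := by
      rcases hle with rfl | h
      exacts [hxy, hxy.trans h]
    have hEay := (hE.between hExy hxa.le hay.le).2
    have hcz : q z x ↔ (!s) = true := by
      rcases hyz with rfl | h
      · exact hc
      · exact colour_trans hq hxy h.1 hc h.2.2
    refine ⟨z, hz, Or.inr ⟨hxz, hE.1.trans hExy hEyz, hcz⟩, fun f hf' => ?_⟩
    have haz : a < z := by
      rcases hle with rfl | h
      exacts [hay, hay.trans h]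
    have hca := hall z hz hle (hE.1.trans hEay hEyz)
    have h1 := hf f hf'
    have mem : ∀ {t}, t ∈ crossingSet q E D s A k → t ∈ D₀ := fun ht =>
      hD (hA (crossingSet_subset k ht))
    obtain ⟨h2, h3⟩ := hf' x (mem hx) a (mem ha) hxa
    have h4 := (hf' a (mem ha) y (mem hy) hay).1
    -- The final point `z` has colour `!s` over `x` but colour `s` over `a`, so the initial segment
    -- of `q` below `z` separates `x` from `a`.
    have h5 : f x ≠ f a := fun e => by
      have := h3 e
      rw [rel_iff_not_rel hq hxz.ne', rel_iff_not_rel hq haz.ne', hcz, hca] at this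
      cases s <;> simp at this
    omega

end Decomposition

/-! ### The inductive decomposition along chain length. -/

section Decomposition

variable {L : FirstOrder.Language.{u, v}} {M : Type w} [L.Structure M] [LinearOrder M]

/-- The elements of `A` with an alternating chain of length `m` in `A` above them which ends with
colour `s`. -/
def fullPart (q E : M → M → Prop) (A : Set M) (s : Bool) (m : ℕ) : Set M :=
  {a | a ∈ A ∧ ∃ y, alt (· < ·) (upper A E a) {u | q u a} s m y}

theorem definable_fullPart {q E : M → M → Prop} (hr : DefinableRel L fun x y : M => x < y)
    (hq : DefinableRel L q) (hE : DefinableRel L E) {A : Set M} (hA : DefinableSet L A) (s : Bool)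
    (m : ℕ) : DefinableSet L (fullPart q E A s m) := by
  have hq' : DefinableRel L fun a u => u ∈ {u | q u a} :=
    definableRel_of (hq.app ⟨_, fun _ => rfl⟩ ⟨_, fun _ => rfl⟩)
  have := definable_alt hr (definable_upper hr hA hE) hq' s m
  exact definableSet_of (DefPred.and (hA.mem ⟨_, fun _ => rfl⟩)
    (DefPred.ex (this.app ⟨_, fun _ => rfl⟩ ⟨_, fun _ => rfl⟩)))

theorem upper_mono {D D' : Set M} {E E' : M → M → Prop} (hD : D' ⊆ D)
    (hE : ∀ x y, E' x y → E x y) (a : M) : upper D' E' a ⊆ upper D E a :=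
  fun _ hu => ⟨hD hu.1, hu.2.1, hE _ _ hu.2.2⟩

variable {q E : M → M → Prop} {D A : Set M} {s : Bool} {m : ℕ}

/-- If there are no alternating chains of length `m + 2` above `a` and there is one of length
`m + 1` which ends with colour `s`, then there is none which ends with colour `!s`. -/
theorem not_alt_of_mem_fullPart {a : M}
    (hlen : ∀ t y, ¬ alt (· < ·) (upper D E a) {u | q u a} t (m + 2) y)
    (ha : a ∈ fullPart q E D s (m + 1)) (y : M) :
    ¬ alt (· < ·) (upper D E a) {u | q u a} (!s) (m + 1) y := by
  have hst : IsStrictTotalOrder M (· < ·) := inferInstance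
  rintro ⟨u, hu, -, hs, h⟩
  obtain ⟨-, z, w, hw, -, hs', h'⟩ := ha
  have hu' : alt (· < ·) (upper D E a) {u | q u a} (!s) (m + 1) u := ⟨u, hu, Or.inl rfl, hs, h⟩
  have hw' : alt (· < ·) (upper D E a) {u | q u a} s (m + 1) w := ⟨w, hw, Or.inl rfl, hs', h'⟩
  rcases le_total u w with huw | huw
  · exact hlen _ _ (hu'.append hst hw huw.eq_or_lt (by simpa using hs'))
  · exact hlen _ _ (hw'.append hst hu huw.eq_or_lt hs)

/-- A chain of length `m + 1` inside `A` cannot end in `s`, as `a` is outside the full part of `A`;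
nor in `!s`, as `a` is in the full part of `D`. -/
theorem not_alt_diff_fullPart
    (hlen : ∀ a ∈ D, ∀ t y, ¬ alt (· < ·) (upper D E a) {u | q u a} t (m + 2) y)
    (hA : A ⊆ fullPart q E D s (m + 1)) {a : M} (ha : a ∈ A \ fullPart q E A s (m + 1))
    (t : Bool) (y : M) :
    ¬ alt (· < ·) (upper (A \ fullPart q E A s (m + 1)) E a) {u | q u a} t (m + 1) y := by
  intro h
  have h' := h.mono_set (upper_mono Set.sdiff_subset (fun _ _ h => h) a)
  by_cases hts : t = s
  · subst hts
    exact ha.2 ⟨ha.1, y, h'⟩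
  · have : t = !s := by cases t <;> cases s <;> simp_all
    subst this
    exact not_alt_of_mem_fullPart (hlen a (hA ha.1).1) (hA ha.1) y
      (h'.mono_set (upper_mono (fun x hx => (hA hx).1) (fun _ _ h => h) a))

theorem tied_left (hE : IsConvexEquiv (· < ·) E) {x y z : M} (hxy : x < y) (hyz : y < z)
    (h : tied q E D s x z) : tied q E D s x y := by
  obtain ⟨-, hEz, t, ht, hzt, hEt, hc⟩ := h
  refine ⟨hxy, (hE.between hEz hxy.le hyz.le).1, t, ht, Or.inr ?_, hEt, hc⟩
  rcases hzt with rfl | hzt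
  exacts [hyz, hyz.trans hzt]

/-- The witness that two elements of the full part of `A` are tied can be found in `A`. -/
theorem exists_mem_of_tied
    (hlen : ∀ a ∈ D, ∀ t y, ¬ alt (· < ·) (upper D E a) {u | q u a} t (m + 2) y)
    (hA : A ⊆ fullPart q E D s (m + 1)) {x y : M} (hx : x ∈ fullPart q E A s (m + 1))
    (hy : y ∈ A) (h : tied q E D s x y) :
    ∃ z ∈ A, y ≤ z ∧ E x z ∧ (q z x ↔ (!s) = true) := by
  have hst : IsStrictTotalOrder M (· < ·) := inferInstance
  have hAD : A ⊆ D := fun x hx => (hA hx).1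
  by_contra! hno
  have hno : ∀ z ∈ A, y ≤ z → E x z → ¬ (q z x ↔ (!s) = true) := fun z hz h1 h2 h3 => by
    have := hno z hz h1 h2
    rcases this with h | h
    · exact absurd (h3.1 h.1) (by simpa using h.2)
    · exact h.1 (h3.2 h.2)
  obtain ⟨hxA, y₀, w, hw, -, hsw, hch⟩ := hx
  obtain ⟨hxy, hEy, z, hz, hyz, hEz, hcz⟩ := h
  have hcy : q y x ↔ s = true := by
    have := hno y hy le_rfl hEy
    cases s <;> simp_all
  -- Drop the last point of a chain in `A` above `x`. What remains ends in `!s`, hence below `y`;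
  -- appending `y` and then `z` gives a forbidden chain of length `m + 2` in `D`.
  have hchain : alt (· < ·) (upper A E x) {u | q u x} (!s) m y := by
    cases m with
    | zero => trivial
    | succ k =>
      obtain ⟨u, hu, huw, hsu, hch⟩ := hch
      refine ⟨u, hu, Or.inr ?_, hsu, hch⟩
      by_contra! hyu
      exact hno u hu.1 hyu hu.2.2 hsu
  have h1 := hchain.append hst (z := y) ⟨hy, hxy, hEy⟩ (Or.inl rfl) (by simpa using hcy)
  have h2 := h1.mono_set (upper_mono hAD (fun _ _ h => h) x)
  have hxz : x < z := by
    rcases hyz with rfl | h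
    exacts [hxy, hxy.trans h]
  exact hlen x (hAD hxA) _ _ (h2.append hst (z := z) ⟨hz, hxz, hEz⟩ hyz (by simpa using hcz))

/-- Without crossings, colour `!s` seen at `z` from `x` must also be seen at or above `z` from every
`a` in between. -/
theorem tied_of_colour (hE : IsConvexEquiv (· < ·) E)
    (hcross : ∀ x ∈ A, ∀ a ∈ A, ∀ z ∈ A, ¬ crossing q E D s x a z) {x a z : M}
    (hx : x ∈ A) (ha : a ∈ A) (hz : z ∈ A) (hxa : x < a)
    (haz : a < z) (hEz : E x z) (hc : q z x ↔ (!s) = true) : tied q E D s a z := by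
  have h := hcross x hx a ha z hz
  by_contra hN
  refine h ⟨hxa, haz, hEz, hc, fun t ht hzt hEt => ?_⟩
  by_contra hct
  refine hN ⟨haz, (hE.between hEz hxa.le haz.le).2, t, ht, hzt, hEt, ?_⟩
  cases s <;> simp_all

theorem tied_right (hE : IsConvexEquiv (· < ·) E)
    (hlen : ∀ a ∈ D, ∀ t y, ¬ alt (· < ·) (upper D E a) {u | q u a} t (m + 2) y)
    (hA : A ⊆ fullPart q E D s (m + 1))
    (hcross : ∀ x ∈ A, ∀ a ∈ A, ∀ z ∈ A, ¬ crossing q E D s x a z) {x y z : M}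
    (hx : x ∈ fullPart q E A s (m + 1)) (hy : y ∈ A) (hz : z ∈ A) (hxy : x < y) (hyz : y < z)
    (h : tied q E D s x z) : tied q E D s y z := by
  obtain ⟨t, ht, hzt, hEt, hc⟩ := exists_mem_of_tied hlen hA hx hz h
  have := tied_of_colour hE hcross hx.1 hy ht hxy (hyz.trans_le hzt) hEt hc
  rcases hzt.eq_or_lt with rfl | hzt
  · exact this
  · exact tied_left hE hyz hzt this

/-- Take witnesses `v`, `w` in `A` for the two ties. If `v` is at or above `z`, it suffices.
Otherwise transitivity of colours combines the first tie with a point seen from `v`: `w` itself if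
`v = y`, and if not, a point supplied by the absence of crossings. -/
theorem tied_trans (hq : IsStrictTotalOrder M q) (hE : IsConvexEquiv (· < ·) E)
    (hlen : ∀ a ∈ D, ∀ t y, ¬ alt (· < ·) (upper D E a) {u | q u a} t (m + 2) y)
    (hA : A ⊆ fullPart q E D s (m + 1))
    (hcross : ∀ x ∈ A, ∀ a ∈ A, ∀ z ∈ A, ¬ crossing q E D s x a z) {x y z : M}
    (hx : x ∈ fullPart q E A s (m + 1)) (hy : y ∈ fullPart q E A s (m + 1)) (hz : z ∈ A)
    (h : tied q E D s x y) (h' : tied q E D s y z) : tied q E D s x z := by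
  obtain ⟨v, hv, hyv, hEv, hcv⟩ := exists_mem_of_tied hlen hA hx hy.1 h
  obtain ⟨w, hw, hzw, hEw, hcw⟩ := exists_mem_of_tied hlen hA hy hz h'
  have hxy := h.1
  have hyz := h'.1
  have hAD : A ⊆ D := fun x hx => (hA hx).1
  have hExz := hE.1.trans h.2.1 h'.2.1
  rcases le_or_gt z v with hzv | hvz
  · exact ⟨hxy.trans hyz, hExz, v, hAD hv, hzv.eq_or_lt, hEv, hcv⟩
  rcases hyv.eq_or_lt with rfl | hyv
  · exact ⟨hxy.trans hyz, hExz, w, hAD hw, hzw.eq_or_lt, hE.1.trans h.2.1 hEw,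
      colour_trans hq hxy (hyz.trans_le hzw) hcv hcw⟩
  · have hvw := hvz.trans_le hzw
    obtain ⟨-, hEvw, t, ht, hwt, hEt, hct⟩ := tied_of_colour hE hcross hy.1 hv hw hyv hvw hEw hcw
    have hzt : z ≤ t := hzw.trans (le_iff_eq_or_lt.mpr hwt)
    exact ⟨hxy.trans hyz, hExz, t, ht, hzt.eq_or_lt, hE.1.trans hEv hEt,
      colour_trans hq (hxy.trans hyv) (hvz.trans_le hzt) hcv hct⟩

theorem tied_of_hull (hE : IsConvexEquiv (· < ·) E)
    (hlen : ∀ a ∈ D, ∀ t y, ¬ alt (· < ·) (upper D E a) {u | q u a} t (m + 2) y)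
    (hA : A ⊆ fullPart q E D s (m + 1))
    (hcross : ∀ x ∈ A, ∀ a ∈ A, ∀ z ∈ A, ¬ crossing q E D s x a z) {u v : M}
    (hu : u ∈ fullPart q E A s (m + 1)) (hv : v ∈ fullPart q E A s (m + 1)) (huv : u < v)
    (h : hull (fullPart q E A s (m + 1)) (tied q E D s) u v) : tied q E D s u v := by
  rcases h with rfl | ⟨x, y, hx, hy, hN, hxu, -, -, hvy⟩
  · exact absurd huv (lt_irrefl _)
  have hxv : x < v := by
    rcases hxu with rfl | h
    exacts [huv, h.trans huv]
  have h1 : tied q E D s x v := by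
    rcases hvy with rfl | h
    exacts [hN, tied_left hE hxv h hN]
  rcases hxu with rfl | h
  · exact h1
  · exact tied_right hE hlen hA hcross hx hu.1 hv.1 h huv h1

theorem hull_le {N : M → M → Prop} (hE : IsConvexEquiv (· < ·) E) (hN : ∀ x y, N x y → E x y)
    {u v : M} (h : hull A N u v) : E u v := by
  rcases h with rfl | ⟨x, y, -, -, h, h1, h2, h3, h4⟩
  · exact hE.1.refl _
  · rw [← le_iff_eq_or_lt] at h1 h2 h3 h4
    exact hE.1.trans (hE.1.symm (hE.between (hN _ _ h) h1 h2).1) (hE.between (hN _ _ h) h3 h4).1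

/-- Inside the hulls of tied elements the length of alternating chains drops. -/
theorem not_alt_upper_hull (hE : IsConvexEquiv (· < ·) E)
    (hlen : ∀ a ∈ D, ∀ t y, ¬ alt (· < ·) (upper D E a) {u | q u a} t (m + 2) y)
    (hA : A ⊆ fullPart q E D s (m + 1))
    (hcross : ∀ x ∈ A, ∀ a ∈ A, ∀ z ∈ A, ¬ crossing q E D s x a z) {a : M}
    (ha : a ∈ fullPart q E A s (m + 1)) (t : Bool) (y : M) :
    ¬ alt (· < ·) (upper (fullPart q E A s (m + 1))
      (hull (fullPart q E A s (m + 1)) (tied q E D s)) a) {u | q u a} t (m + 1) y := by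
  have hst : IsStrictTotalOrder M (· < ·) := inferInstance
  have hsub : upper (fullPart q E A s (m + 1))
      (hull (fullPart q E A s (m + 1)) (tied q E D s)) a ⊆ upper D E a :=
    upper_mono (fun x hx => (hA hx.1).1) (fun _ _ h => hull_le hE (fun _ _ h => h.2.1) h) a
  intro h
  by_cases hts : t = s
  · subst hts
    obtain ⟨u, hu, -, hcu, hch⟩ := h
    obtain ⟨-, -, z, hz, huz, hEz, hcz⟩ := tied_of_hull hE hlen hA hcross ha hu.1 hu.2.1 hu.2.2
    have haz : a < z := by
      rcases huz with rfl | h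
      exacts [hu.2.1, hu.2.1.trans h]
    have h1 : alt (· < ·) (upper D E a) {u | q u a} t (m + 1) u :=
      ⟨u, hsub hu, Or.inl rfl, hcu, hch.mono_set hsub⟩
    exact hlen a (hA ha.1).1 _ _ (h1.append hst (z := z) ⟨hz, haz, hEz⟩ huz hcz)
  · have : t = !s := by cases t <;> cases s <;> simp_all
    subst this
    exact not_alt_of_mem_fullPart (hlen a (hA ha.1).1) (hA ha.1) y (h.mono_set hsub)

/-- If all initial segments of `q` are uniformly tame on `D₀`, then `D₀` decomposes into finitely
many definable sets on which `q` is obtained from the order by successive reversals. -/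
theorem finCover_resolvedOn (hr : DefinableRel L fun x y : M => x < y)
    (hq : IsStrictTotalOrder M q) (hqd : DefinableRel L q) {D₀ : Set M} {n : ℕ}
    (ht : ∀ b, TameOn (· < ·) D₀ n {u | q u b}) (m : ℕ) :
    ∀ D ⊆ D₀, DefinableSet L D → ∀ E, IsConvexEquiv (· < ·) E → DefinableRel L E →
      (∀ a ∈ D, ∀ t y, ¬ alt (· < ·) (upper D E a) {u | q u a} t (m + 1) y) →
      FinCover (ResolvedOn L (· < ·) q E) D := by
  induction m with
  | zero =>
    classical
    intro D _ hDd E hE hEd hlen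
    have hno : ∀ x ∈ D, ∀ y ∈ D, E x y → ¬ x < y := fun x hx y hy hxy hlt =>
      -- A chain of length one is a single point of either colour, so here each `E`-class meets `D`
      -- in at most one point.
      hlen x hx (decide (q y x)) y ⟨y, ⟨hy, hlt, hxy⟩, Or.inl rfl, by simp, trivial⟩
    refine .base ⟨hDd, [], by simp, List.Pairwise.nil, fun x hx y hy hxy => ?_⟩
    obtain rfl : x = y :=
      le_antisymm (not_lt.mp (hno y hy x hx (hE.1.symm hxy))) (not_lt.mp (hno x hx y hy hxy))
    exact iff_of_false (hq.irrefl x) (lt_irrefl x)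
  | succ m ih =>
    intro D hD hDd E hE hEd hlen
    have piece : ∀ s : Bool, ∀ A, DefinableSet L A → A ⊆ fullPart q E D s (m + 1) →
        (∀ x ∈ A, ∀ a ∈ A, ∀ z ∈ A, ¬ crossing q E D s x a z) →
        FinCover (ResolvedOn L (· < ·) q E) A := by
      intro s A hAd hA hcross
      have hAD : A ⊆ D := fun x hx => (hA hx).1
      have hG : DefinableSet L (fullPart q E A s (m + 1)) :=
        definable_fullPart hr hqd hEd hAd s (m + 1)
      have hGA : fullPart q E A s (m + 1) ⊆ A := fun x hx => hx.1
      -- The full part is taken again relative to `A`: this puts the witnesses of ties in `A`, where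
      -- crossings are excluded. The rest of `A` has shorter chains.
      refine .split (fullPart q E A s (m + 1)) ?_ (ih _
        ((Set.sdiff_subset.trans hAD).trans hD) (hAd.diff hG) E hE hEd
        fun a ha => not_alt_diff_fullPart hlen hA ha)
      rw [Set.inter_eq_right.mpr hGA]
      have hN := definable_tied hr hqd hEd hDd s
      have hF : IsConvexEquiv (· < ·) (hull (fullPart q E A s (m + 1)) (tied q E D s)) :=
        isConvexEquiv_hull (fun x _ y _ z _ hxy hyz h => tied_left hE hxy hyz h)
          fun x hx y hy z hz _ _ h h' => tied_trans hq hE hlen hA hcross hx hy hz.1 h h'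
      have hFd := definable_hull hr hN hG
      refine (ih _ ((hGA.trans hAD).trans hD) hG _ hF hFd fun a ha =>
        not_alt_upper_hull hE hlen hA hcross ha).bind fun B hB hres => .base ?_
      refine hres.extend inferInstance hq hE hEd hF hFd
        (fun _ _ h => hull_le hE (fun _ _ h => h.2.1) h) (s := s) fun x hx y hy hxy hE' hF' => ?_
      by_contra hc
      -- If the pair had colour `!s`, then `y` itself would witness a tie between `x` and `y`.
      refine hF' (Or.inr ⟨x, y, hB hx, hB hy, ⟨hxy, hE', y, hAD (hGA (hB hy)), Or.inl rfl, hE',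
        ?_⟩, Or.inl rfl, Or.inr hxy, Or.inr hxy, Or.inl rfl⟩)
      cases s <;> simp_all
    have full : ∀ s : Bool, ∀ A, DefinableSet L A → A ⊆ fullPart q E D s (m + 1) →
        FinCover (ResolvedOn L (· < ·) q E) A := by
      intro s A hAd hA
      have hAD : A ⊆ D := fun x hx => (hA hx).1
      have hX := definable_crossingSet hr hqd hEd hDd s hAd
      -- Each successive crossing raises the tameness function of one initial segment of `q`, and
      -- that function is bounded by `n`.
      have hempty : crossingSet q E D s A (n + 1) = ∅ := by
        refine Set.eq_empty_of_forall_notMem fun x hx => ?_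
        obtain ⟨z, -, -, hf⟩ := exists_of_mem_crossingSet hq hE hD hAD hx
        obtain ⟨f, hfn, hf'⟩ := ht z
        have := hf f hf'
        have := hfn z
        omega
      have hk : ∀ k, FinCover (ResolvedOn L (· < ·) q E) (A \ crossingSet q E D s A k) := by
        intro k
        induction k with
        | zero =>
          rw [crossingSet, sdiff_self]
          exact .base (resolvedOn_empty _ _)
        | succ k ihk =>
          have hu : A \ crossingSet q E D s A (k + 1) = (A \ crossingSet q E D s A k) ∪
              (crossingSet q E D s A k \ crossingSet q E D s A (k + 1)) := by
            rw [Set.sdiff_union_sdiff_cancel (crossingSet_subset k) (crossingSet_succ_subset k)]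
          rw [hu]
          refine ihk.union (piece s _ ((hX k).diff (hX (k + 1)))
            (Set.sdiff_subset.trans ((crossingSet_subset k).trans hA)) ?_)
          exact fun x hx a ha z hz h => hx.2 ⟨hx.1, a, z, ha.1, hz.1, h⟩
      have := hk (n + 1)
      rwa [hempty, Set.sdiff_empty] at this
    have hP : ∀ s, DefinableSet L (fullPart q E D s (m + 1)) := fun s =>
      definable_fullPart hr hqd hEd hDd s (m + 1)
    refine .split (fullPart q E D true (m + 1)) (full true _ (hDd.inter (hP _))
      Set.inter_subset_right) ?_
    refine .split (fullPart q E D false (m + 1)) (full false _ ((hDd.diff (hP _)).inter (hP _))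
      Set.inter_subset_right) ?_
    -- Points in neither full part have no chain of length `m + 1` of either final colour.
    refine ih _ ((Set.sdiff_subset.trans Set.sdiff_subset).trans hD) ((hDd.diff (hP _)).diff (hP _))
      E hE hEd fun a ha t y h => ?_
    have h' := h.mono_set (upper_mono (Set.sdiff_subset.trans Set.sdiff_subset) (fun _ _ h => h) a)
    cases t with
    | true => exact ha.1.2 ⟨ha.1.1, y, h'⟩
    | false => exact ha.2 ⟨ha.1.1, y, h'⟩

end Decomposition

/-! ### Passing uniform tameness to all definable orders. -/

section Transfer

variable {L : FirstOrder.Language.{u, v}} {M : Type w} [L.Structure M]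

variable (L) in
/-- For every definable relation `S`, the sets `{u | S b u}` are uniformly tame with respect to
`r` on the members of a finite definable cover. -/
def UniformlyTame (r : M → M → Prop) : Prop :=
  ∀ S : M → M → Prop, DefinableRel L S →
    FinCover (fun D => DefinableSet L D ∧ ∃ n, ∀ b, TameOn r D n {u | S b u}) Set.univ

/-- The universe decomposes into finitely many definable sets on which a given definable order is
`r_E` for a decreasing sequence `E`. -/
theorem UniformlyTame.exists_seqOrder {r q : M → M → Prop} (h : UniformlyTame L r)
    (hr : IsStrictTotalOrder M r) (hrd : DefinableRel L r) (hq : IsStrictTotalOrder M q)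
    (hqd : DefinableRel L q) :
    FinCover (fun D => DefinableSet L D ∧ ∃ Es : List (M → M → Prop),
      (∀ E ∈ Es, DefinableRel L E) ∧ IsAdmissible r Es ∧ IsDecreasing Es ∧
        ∀ x ∈ D, ∀ y ∈ D, q x y ↔ seqOrder r Es x y) Set.univ := by
  classical
  let _ : LinearOrder M := linearOrderOfSTO r
  have hqd' : DefinableRel L fun b u => q u b :=
    definableRel_of (hqd.app ⟨_, fun _ => rfl⟩ ⟨_, fun _ => rfl⟩)
  have hT : IsConvexEquiv r fun _ _ : M => True :=
    ⟨⟨fun _ => trivial, fun _ => trivial, fun _ _ => trivial⟩, fun _ _ _ _ _ _ _ _ => trivial⟩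
  refine (h _ hqd').bind fun D _ ⟨hD, n, ht⟩ => ?_
  -- The induction starts with a single class; tameness with bound `n` excludes chains of length `n
  -- + 2`.
  have := finCover_resolvedOn (L := L) (q := q) hrd hq hqd ht (n + 1) D subset_rfl hD _ hT
    (DefPred.const True) fun a _ t y => (ht a).not_alt fun u hu => hu.1
  refine this.bind fun B _ ⟨hB, Es, hEs, hdec, hres⟩ => .base ⟨hB, Es, fun E hE => (hEs E hE).1,
    isAdmissible_of_isDecreasing (fun E hE => (hEs E hE).2.1) hdec, hdec,
    fun x hx y hy => hres x hx y hy trivial⟩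

theorem UniformlyTame.transfer {r q : M → M → Prop} (h : UniformlyTame L r)
    (hr : IsStrictTotalOrder M r) (hrd : DefinableRel L r) (hq : IsStrictTotalOrder M q)
    (hqd : DefinableRel L q) : UniformlyTame L q := by
  intro S hS
  have := (h S hS).inter (h.exists_seqOrder hr hrd hq hqd)
    (R := fun D => DefinableSet L D ∧ ∃ n, ∀ b, TameOn q D n {u | S b u}) ?_
  · rwa [Set.univ_inter] at this
  rintro C D ⟨hC, n, hn⟩ ⟨hD, Es, -, hadm, -, hres⟩
  refine .base ⟨hC.inter hD, ?_⟩
  obtain ⟨k, hk⟩ := TameOn.seqOrder hr hadm (n := n)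
  refine ⟨k, fun b => ?_⟩
  obtain ⟨f, hf, hf'⟩ := hk C _ (hn b)
  exact ⟨f, hf, fun x hx y hy hxy => hf' x hx.1 y hy.1 ((hres x hx.2 y hy.2).mp hxy)⟩

end Transfer

open FirstOrder FirstOrder.Language

/-! ### Compactness for a directed family of formulas. -/

section Compactness

variable {L : FirstOrder.Language.{u, v}} {T : L.Theory}

/-- If each formula of a directed family is realized in a model of `T`, then some model contains a
tuple which realizes all of them. -/
theorem exists_realize_all {ι : Type*} [Preorder ι] [IsDirectedOrder ι] [Nonempty ι]
    {α : Type} (ψ : ι → L.Formula α)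
    (h : ∀ i, ∃ (N : Theory.ModelType.{u, v, max u v} T) (b : α → N),
      ∀ j ≤ i, (ψ j).Realize b) :
    ∃ (N : Theory.ModelType.{u, v, max u v} T) (b : α → N), ∀ i, (ψ i).Realize b := by
  let Th : ι → L[[α]].Theory := fun i =>
    (L.lhomWithConstants α).onTheory T ∪ {σ | ∃ j ≤ i, σ = Formula.equivSentence (ψ j)}
  have hdir : Directed (· ⊆ ·) Th := by
    refine Monotone.directed_le fun i j hij => ?_
    exact Set.union_subset_union_right _ fun σ ⟨k, hk, hσ⟩ => ⟨k, hk.trans hij, hσ⟩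
  have hsat : Theory.IsSatisfiable (⋃ i, Th i) := by
    rw [Theory.isSatisfiable_directed_union_iff hdir]
    intro i
    obtain ⟨N, b, hb⟩ := h i
    let _ : (constantsOn α).Structure N := constantsOn.structure b
    have hN : N ⊨ Th i := by
      refine Theory.model_iff _ |>.mpr ?_
      rintro σ (hσ | ⟨j, hj, rfl⟩)
      · have : N ⊨ (L.lhomWithConstants α).onTheory T :=
          (LHom.onTheory_model _ _).2 inferInstance
        exact Theory.realize_sentence_of_mem _ hσ
      · exact (Formula.realize_equivSentence _ _).2 (hb j hj)
    exact ⟨Theory.ModelType.of (Th i) N⟩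
  obtain ⟨N⟩ := hsat
  obtain ⟨i₀⟩ := ‹Nonempty ι›
  have hsub : (L.lhomWithConstants α).onTheory T ⊆ ⋃ i, Th i :=
    Set.subset_union_left.trans (Set.subset_iUnion Th i₀)
  refine ⟨(N.subtheoryModel hsub).reduct (L.lhomWithConstants α), fun a => (L.con a : N),
    fun i => ?_⟩
  have hi : Formula.equivSentence (ψ i) ∈ ⋃ i, Th i :=
    Set.mem_iUnion.mpr ⟨i, Or.inr ⟨i, le_rfl, rfl⟩⟩
  have := Theory.realize_sentence_of_mem (M := N) _ hi
  exact (@Formula.realize_equivSentence L N ((L.lhomWithConstants α).reduct N) α N.struc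
    (LHom.isExpansionOn_reduct _ _) (ψ i)).mp this

end Compactness

/-! ### Alternation inside finite-type classes as a first-order formula. -/

section AltFormula

variable {L : FirstOrder.Language.{u, v}}

/-- The elements which satisfy the same formulas of `Δ` as `y`. -/
def typeClass {M : Type w} [L.Structure M] (Δ : Finset (L.Formula (Fin 1))) (y : M) : Set M :=
  {u | ∀ δ ∈ Δ, δ.Realize (fun _ => u) ↔ δ.Realize fun _ => y}

/-- The formula expressing that two elements have the same `Δ`-type. -/
noncomputable def sameTypeFormula (Δ : Finset (L.Formula (Fin 1))) : L.Formula (Fin 2) :=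
  Formula.iInf fun δ : Δ => (δ.1.relabel fun _ => 0).iff (δ.1.relabel fun _ => 1)

/-- The formula expressing `alt` for the `Δ`-class of the second variable, and for the subset
defined by `φ` with the first variable as a parameter. -/
noncomputable def altFormula (lt : L.Formula (Fin 2)) (Δ : Finset (L.Formula (Fin 1)))
    (φ : L.Formula (Fin 2)) : Bool → ℕ → L.Formula (Fin 2)
  | _, 0 => ⊤
  | s, m + 1 => Formula.iExs (Fin 1)
      (((sameTypeFormula Δ).relabel ![Sum.inr 0, Sum.inl 1] ⊓
        ((Term.var (Sum.inr 0)).equal (Term.var (Sum.inl 1)) ⊔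
          lt.relabel ![Sum.inr 0, Sum.inl 1])) ⊓
        ((if s then φ.relabel ![Sum.inl 0, Sum.inr 0] else
          (φ.relabel ![Sum.inl 0, Sum.inr 0]).not) ⊓
          (altFormula lt Δ φ (!s) m).relabel ![Sum.inl 0, Sum.inr 0]))

variable {M : Type w} [L.Structure M]

theorem realize_sameTypeFormula {Δ : Finset (L.Formula (Fin 1))} {x y : M} :
    (sameTypeFormula Δ).Realize ![x, y] ↔ x ∈ typeClass Δ y := by
  have e : ∀ (x y : M) (i : Fin 2), (![x, y] : Fin 2 → M) ∘ (fun _ : Fin 1 => i) =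
      fun _ => ![x, y] i := fun _ _ _ => rfl
  simp [sameTypeFormula, typeClass, Formula.realize_iInf, Formula.realize_relabel, e]

theorem typeClass_eq {Δ : Finset (L.Formula (Fin 1))} {x y : M} (h : x ∈ typeClass Δ y) :
    typeClass Δ x = typeClass Δ y :=
  Set.ext fun _ => forall₂_congr fun δ hδ => by rw [h δ hδ]

theorem realize_altFormula {lt φ : L.Formula (Fin 2)} {Δ : Finset (L.Formula (Fin 1))} {s : Bool}
    {m : ℕ} {b y : M} : (altFormula lt Δ φ s m).Realize ![b, y] ↔
      alt (fun x y => lt.Realize ![x, y]) (typeClass Δ y) {u | φ.Realize ![b, u]} s m y := by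
  induction m generalizing s y with
  | zero => simp [altFormula, alt]
  | succ m ih =>
    have e1 : ∀ (x : Fin 1 → M), (Sum.elim ![b, y] x : Fin 2 ⊕ Fin 1 → M) ∘
        ![Sum.inr 0, Sum.inl 1] = ![x 0, y] := fun x => by ext i; fin_cases i <;> rfl
    have e2 : ∀ (x : Fin 1 → M), (Sum.elim ![b, y] x : Fin 2 ⊕ Fin 1 → M) ∘
        ![Sum.inl 0, Sum.inr 0] = ![b, x 0] := fun x => by ext i; fin_cases i <;> rfl
    have e3 : ∀ x : Fin 1 → M, Formula.Realize (if s then φ.relabel ![Sum.inl 0, Sum.inr 0] else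
          (φ.relabel ![Sum.inl 0, Sum.inr 0]).not) (Sum.elim ![b, y] x) ↔
          (φ.Realize ![b, x 0] ↔ s = true) := by
      intro x
      cases s <;> simp [Formula.realize_not, Formula.realize_relabel, e2]
    simp only [altFormula, alt, Formula.realize_iExs, Formula.realize_inf, Formula.realize_sup,
      Formula.realize_relabel, e1, e2, e3, ih, realize_sameTypeFormula, Formula.realize_equal,
      Term.realize_var, Sum.elim_inl, Sum.elim_inr]
    constructor
    · rintro ⟨x, ⟨h1, h2⟩, h3, h4⟩
      exact ⟨x 0, h1, h2, h3, typeClass_eq h1 ▸ h4⟩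
    · rintro ⟨u, h1, h2, h3, h4⟩
      exact ⟨fun _ => u, ⟨h1, h2⟩, h3, (typeClass_eq h1).symm ▸ h4⟩

theorem alt.of_add {X : Type w} {r : X → X → Prop} (hr : IsStrictTotalOrder X r) {K P : Set X}
    {s : Bool} {m : ℕ} (k : ℕ) {y : X} (h : alt r K P s (m + k) y) : ∃ t, alt r K P t m y := by
  induction k generalizing s y with
  | zero => exact ⟨s, h⟩
  | succ k ih =>
    obtain ⟨u, -, huy, -, h⟩ := h
    exact ih (h.mono_right hr huy)

/-- The formula expressing that there is an alternating chain of length `n` inside some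
`Δ`-class. -/
noncomputable def alternatesFormula (lt : L.Formula (Fin 2)) (φ : L.Formula (Fin 2))
    (i : Finset (L.Formula (Fin 1)) × ℕ) : L.Formula (Fin 1) :=
  Formula.iExs (Fin 1) ((altFormula lt i.1 φ true i.2 ⊔ altFormula lt i.1 φ false i.2).relabel
    ![Sum.inl 0, Sum.inr 0])

theorem realize_alternatesFormula {lt φ : L.Formula (Fin 2)}
    {i : Finset (L.Formula (Fin 1)) × ℕ} {b : Fin 1 → M} :
    (alternatesFormula lt φ i).Realize b ↔ ∃ y s, alt (fun x y => lt.Realize ![x, y])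
      (typeClass i.1 y) {u | φ.Realize ![b 0, u]} s i.2 y := by
  have e : ∀ (x : Fin 1 → M), (Sum.elim b x : Fin 1 ⊕ Fin 1 → M) ∘
        ![Sum.inl 0, Sum.inr 0] = ![b 0, x 0] := fun x => by ext i; fin_cases i <;> rfl
  simp only [alternatesFormula, Formula.realize_iExs, Formula.realize_relabel, e,
    Formula.realize_sup, realize_altFormula]
  constructor
  · rintro ⟨x, h | h⟩
    exacts [⟨_, _, h⟩, ⟨_, _, h⟩]
  · rintro ⟨y, s, h⟩
    refine ⟨fun _ => y, ?_⟩
    cases s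
    exacts [Or.inr h, Or.inl h]

/-- Finer classes and longer chains give stronger formulas; compactness can thus be applied along
the directed order of pairs. -/
theorem realize_alternatesFormula_anti {lt φ : L.Formula (Fin 2)}
    (hlt : IsStrictTotalOrder M fun x y => lt.Realize ![x, y])
    {i j : Finset (L.Formula (Fin 1)) × ℕ} (hij : j ≤ i) {b : Fin 1 → M}
    (h : (alternatesFormula lt φ i).Realize b) : (alternatesFormula lt φ j).Realize b := by
  rw [realize_alternatesFormula] at h ⊢
  obtain ⟨y, s, h⟩ := h
  obtain ⟨k, hk⟩ := Nat.exists_eq_add_of_le hij.2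
  rw [hk] at h
  obtain ⟨t, ht⟩ := alt.of_add hlt k h
  have hsub : typeClass i.1 y ⊆ typeClass j.1 y := fun u hu δ hδ => hu δ (hij.1 hδ)
  exact ⟨y, t, ht.mono_set hsub⟩

/-- A finite Boolean combination of convex and definable sets is tame on the `Δ`-classes for some
finite `Δ`. -/
theorem exists_tameOn_of_mem_closure {r : M → M → Prop} (hr : IsStrictTotalOrder M r) {A : Set M}
    (hA : A ∈ BooleanSubalgebra.closure
      ({C : Set M | IsConvex r C} ∪ {C : Set M | (∅ : Set M).Definable₁ L C})) :
    ∃ (Δ : Finset (L.Formula (Fin 1))) (n : ℕ), ∀ c, TameOn r (typeClass Δ c) n A := by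
  classical
  induction hA using BooleanSubalgebra.closure_bot_sup_induction with
  | mem A hA =>
    rcases hA with hA | hA
    · exact ⟨∅, 2, fun c => .of_convex hr hA⟩
    · obtain ⟨δ, hδ⟩ := Set.empty_definable_iff.mp hA
      have hδ' : ∀ x, x ∈ A ↔ δ.Realize fun _ => x := fun x => by
        have : (fun _ : Fin 1 => x) ∈ {v : Fin 1 → M | v 0 ∈ A} ↔ _ := Set.ext_iff.mp hδ _
        exact this
      refine ⟨{δ}, 0, fun c => .of_const fun x hx y hy => ?_⟩
      rw [hδ', hδ', hx δ (by simp), hy δ (by simp)]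
  | bot => exact ⟨∅, 0, fun c => .of_const fun x _ y _ => Iff.rfl⟩
  | sup A _ B _ ihA ihB =>
    obtain ⟨Δ, n, h⟩ := ihA
    obtain ⟨Δ', n', h'⟩ := ihB
    refine ⟨Δ ∪ Δ', n + n', fun c => ((h c).union (h' c)).mono_set fun x hx => ⟨fun δ hδ => ?_,
      fun δ hδ => ?_⟩⟩
    · exact hx δ (Finset.mem_union_left _ hδ)
    · exact hx δ (Finset.mem_union_right _ hδ)
  | compl A _ ih =>
    obtain ⟨Δ, n, h⟩ := ih
    exact ⟨Δ, n, fun c => (h c).compl⟩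

end AltFormula

/-! ### Uniform tameness of the distinguished order. -/

section WeaklyQuasiOMinimal

variable {L : FirstOrder.Language.{u, v}} {T : L.Theory} {lt : L.Formula (Fin 2)}

theorem definable_param {N : Type w} [L.Structure N] (φ : L.Formula (Fin 2)) (b : N) :
    (Set.univ : Set N).Definable₁ L {u | φ.Realize ![b, u]} := by
  refine Set.definable_iff_exists_formula_sum.mpr
    ⟨φ.relabel ![Sum.inl ⟨b, Set.mem_univ b⟩, Sum.inr 0], ?_⟩
  ext v
  have : (Sum.elim (↑) v : (Set.univ : Set N) ⊕ Fin 1 → N) ∘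
      ![Sum.inl ⟨b, Set.mem_univ b⟩, Sum.inr 0] = ![b, v 0] := by
    ext i
    fin_cases i <;> rfl
  simp only [Set.mem_ofPred_eq, Formula.realize_relabel, this]

/-- Compactness: the number of alternations is bounded uniformly in the parameter. -/
theorem IsWeaklyQuasiOMinimalWrt.exists_models (h : IsWeaklyQuasiOMinimalWrt T lt)
    (φ : L.Formula (Fin 2)) : ∃ i, T ⊨ᵇ (alternatesFormula lt φ i).not := by
  classical
  by_contra! hno
  obtain ⟨N, b, hb⟩ := exists_realize_all (T := T) (alternatesFormula lt φ) (by
    intro i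
    have := hno i
    rw [Theory.models_formula_iff] at this
    push Not at this
    obtain ⟨N, b, hb⟩ := this
    rw [Formula.realize_not, not_not] at hb
    exact ⟨N, b, fun j hj => realize_alternatesFormula_anti (h N).1 hj hb⟩)
  obtain ⟨hN, hc⟩ := h N
  obtain ⟨Δ, n, ht⟩ := exists_tameOn_of_mem_closure hN (hc _ (definable_param φ (b 0)))
  obtain ⟨y, s, hs⟩ := realize_alternatesFormula.mp (hb (Δ, n + 2))
  exact (ht y).not_alt subset_rfl hs

theorem comp_pair {α N : Type*} (v : α → N) (i j : α) : v ∘ ![i, j] = ![v i, v j] := by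
  ext k
  fin_cases k <;> rfl

/-- The assumption speaks of models in one universe only. The order axioms form one formula, so
being a consequence of `T` they hold in models of any universe. -/
theorem IsWeaklyQuasiOMinimalWrt.isStrictTotalOrder (h : IsWeaklyQuasiOMinimalWrt T lt)
    (M : Theory.ModelType.{u, v, w} T) :
    IsStrictTotalOrder M fun a b => lt.Realize ![a, b] := by
  let lt' : Fin 3 → Fin 3 → L.Formula (Fin 3) := fun i j => lt.relabel ![i, j]
  let φ : L.Formula (Fin 3) := (lt' 0 0).not ⊓ (((lt' 0 1).imp ((lt' 1 2).imp (lt' 0 2))) ⊓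
    ((lt' 0 1).not.imp ((lt' 1 0).not.imp ((Term.var 0).equal (Term.var 1)))))
  have hφ : T ⊨ᵇ φ := by
    rw [Theory.models_formula_iff]
    intro N v
    have hN := (h N).1
    simp only [φ, lt', Formula.realize_inf, Formula.realize_not, Formula.realize_imp,
      Formula.realize_relabel, comp_pair, Formula.realize_equal, Term.realize_var]
    exact ⟨hN.irrefl _, hN.trans _ _ _, hN.trichotomous _ _⟩
  have key : ∀ a b c : M, _ := fun a b c => hφ.realize_formula M (v := ![a, b, c])
  simp only [φ, lt', Formula.realize_inf, Formula.realize_not, Formula.realize_imp,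
    Formula.realize_relabel, comp_pair, Formula.realize_equal, Term.realize_var] at key
  exact { irrefl := fun a => (key a a a).1
          trans := fun a b c => (key a b c).2.1
          trichotomous := fun a b => (key a b a).2.2 }

theorem finCover_typeClass {M : Type w} [L.Structure M] (Δ : Finset (L.Formula (Fin 1))) :
    FinCover (fun D : Set M => DefinableSet L D ∧ ∀ x ∈ D, ∀ y ∈ D, x ∈ typeClass Δ y)
      Set.univ := by
  classical
  induction Δ using Finset.induction_on with
  | empty => exact .base ⟨definableSet_univ, fun x _ y _ δ hδ => by simp at hδ⟩
  | insert δ Δ _ ih =>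
    have hδ : DefinableSet L {x : M | δ.Realize fun _ => x} :=
      Set.empty_definable_iff.mpr ⟨δ, by
        ext v
        have : (fun _ => v 0) = v := by ext i; fin_cases i; rfl
        simp [this]⟩
    refine ih.bind fun D _ ⟨hD, h⟩ => .split {x : M | δ.Realize fun _ => x}
      (.base ⟨hD.inter hδ, fun x hx y hy γ hγ => ?_⟩)
      (.base ⟨hD.diff hδ, fun x hx y hy γ hγ => ?_⟩)
    · rcases Finset.mem_insert.mp hγ with rfl | hγ
      · exact iff_of_true hx.2 hy.2
      · exact h x hx.1 y hy.1 γ hγ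
    · rcases Finset.mem_insert.mp hγ with rfl | hγ
      · exact iff_of_false hx.2 hy.2
      · exact h x hx.1 y hy.1 γ hγ

theorem IsWeaklyQuasiOMinimalWrt.uniformlyTame (h : IsWeaklyQuasiOMinimalWrt T lt)
    (M : Theory.ModelType.{u, v, w} T) :
    UniformlyTame L fun a b : M => lt.Realize ![a, b] := by
  intro S hS
  have hM := h.isStrictTotalOrder M
  obtain ⟨φ, hφ⟩ := Set.empty_definable_iff.mp hS
  have hφ' : ∀ b u, S b u ↔ φ.Realize ![b, u] := fun b u => by
    have : ![b, u] ∈ {v : Fin 2 → M | S (v 0) (v 1)} ↔ _ := Set.ext_iff.mp hφ _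
    exact this
  obtain ⟨⟨Δ, n⟩, hmod⟩ := h.exists_models φ
  refine (finCover_typeClass Δ).bind fun D _ ⟨hD, hc⟩ => .base ⟨hD, n, fun b => ?_⟩
  refine .of_not_alt hM fun s y halt => ?_
  obtain ⟨u, hu, -, hs, ha⟩ := halt
  have ha : alt (fun a b : M => lt.Realize ![a, b]) D {u | S b u} s (n + 1) u :=
    ⟨u, hu, Or.inl rfl, hs, ha⟩
  -- The formula excludes chains of length `n`, while `TameOn.of_not_alt` asks about length `n + 1`.
  -- The endpoint was moved to `u ∈ D` so that `D` lies in its type class.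
  obtain ⟨t, ht⟩ := ha.of_add hM 1
  have := hmod.realize_formula M (v := fun _ => b)
  rw [Formula.realize_not, realize_alternatesFormula] at this
  refine this ⟨u, t, ?_⟩
  simp only [← hφ']
  exact ht.mono_set fun x hx => hc x hx u hu

end WeaklyQuasiOMinimal

/-! ### Generation of binary relations by weakly monotone ones. -/

section BinaryRelations

variable {L : FirstOrder.Language.{u, v}} {M : Type w} [L.Structure M]

variable (L) in
/-- The definable relations which are upward closed in the first variable. -/
def upRels (r : M → M → Prop) : Set (Set (M × M)) :=
  {U | (∅ : Set M).Definable₂ L U ∧ ∀ a a' b, r a a' → (a, b) ∈ U → (a', b) ∈ U}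

theorem definableRel_mem {R : Set (M × M)} (h : (∅ : Set M).Definable₂ L R) :
    DefinableRel L fun a b => (a, b) ∈ R := h

/-- Membership in a tame set can be read off from the maximal lengths of alternating chains. -/
theorem mem_iff_exists_alt {X : Type w} {r : X → X → Prop} (hr : IsStrictTotalOrder X r)
    {D A : Set X} {n : ℕ} (h : TameOn r D n A) {x : X} (hx : x ∈ D) :
    x ∈ A ↔ ∃ m ∈ Finset.range (n + 2), alt r D A true (m + 1) x ∧ ¬ alt r D A false (m + 2) x := by
  constructor
  · intro hA
    by_contra! hno
    -- If no length is final, a chain ending in `A` has a longer companion ending outside `A`, to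
    -- which `x` can be appended; the lengths grow without bound.
    have hk : ∀ k, alt r D A true (2 * k + 1) x := by
      intro k
      induction k with
      | zero => exact ⟨x, hx, Or.inl rfl, by simpa using hA, trivial⟩
      | succ k ih =>
        have hlt : 2 * k < n + 2 := by
          by_contra! hle
          obtain ⟨j, hj⟩ := Nat.exists_eq_add_of_le hle
          have ih' : alt r D A true (n + 2 + (j + 1)) x := by
            rw [← add_assoc, ← hj]
            exact ih
          obtain ⟨t, ht⟩ := alt.of_add hr _ ih'
          exact h.not_alt subset_rfl ht
        have := hno (2 * k) (Finset.mem_range.mpr hlt) ih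
        exact this.append hr hx (Or.inl rfl) (by simpa using hA)
    have h1 : alt r D A true (n + 2 + (n + 3)) x := by
      have := hk (n + 2)
      rwa [show 2 * (n + 2) + 1 = n + 2 + (n + 3) by omega] at this
    obtain ⟨t, ht⟩ := alt.of_add hr _ h1
    exact h.not_alt subset_rfl ht
  · rintro ⟨m, -, h1, h2⟩
    by_contra hA
    exact h2 (h1.append hr hx (Or.inl rfl) (by simpa using hA))

/-- Every definable relation is a finite Boolean combination of unary ones and of relations which
are upward closed in the first variable. -/
theorem mem_closure_upRels {r : M → M → Prop} (hr : IsStrictTotalOrder M r)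
    (hrd : DefinableRel L r) (h : UniformlyTame L r) {R : Set (M × M)}
    (hR : (∅ : Set M).Definable₂ L R) :
    R ∈ BooleanSubalgebra.closure (unarySets L M ∪ upRels L r) := by
  have hR' := definableRel_mem hR
  have hS : DefinableRel L fun b u => (u, b) ∈ R :=
    definableRel_of (hR'.app ⟨_, fun _ => rfl⟩ ⟨_, fun _ => rfl⟩)
  have key := (h _ hS).of_union
    (Q := fun D => {p : M × M | p ∈ R ∧ p.1 ∈ D} ∈
      BooleanSubalgebra.closure (unarySets L M ∪ upRels L r)) ?_ ?_
  · simpa using key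
  · rintro D ⟨hD, n, hn⟩
    let U : ℕ → Bool → Set (M × M) := fun m s => {p | alt r D {u | (u, p.2) ∈ R} s m p.1}
    have hU : ∀ m s, U m s ∈ BooleanSubalgebra.closure (unarySets L M ∪ upRels L r) := by
      intro m s
      refine BooleanSubalgebra.mem_closure_of_mem (Or.inr ⟨?_, fun a a' b haa h =>
        h.mono_right hr (Or.inr haa)⟩)
      have hK : DefinableRel L fun (_ : M) u => u ∈ D := definableRel_of (hD.mem ⟨_, fun _ => rfl⟩)
      have := definable_alt hrd hK (P := fun b => {u | (u, b) ∈ R}) hS s m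
      exact definableRel_of (r := fun a b => alt r D {u | (u, b) ∈ R} s m a)
        (this.app (f := fun v => v 1) (g := fun v => v 0) ⟨_, fun _ => rfl⟩ ⟨_, fun _ => rfl⟩)
    have hfin : (Finset.range (n + 2)).sup (fun m => U (m + 1) true \ U (m + 2) false) ∈
        BooleanSubalgebra.closure (unarySets L M ∪ upRels L r) :=
      Finset.sup_mem _ BooleanSubalgebra.bot_mem (fun _ h _ => BooleanSubalgebra.sup_mem h) _ _
        fun m _ => BooleanSubalgebra.sdiff_mem (hU _ _) (hU _ _)
    have hun : {p : M × M | p.1 ∈ D} ∈ BooleanSubalgebra.closure (unarySets L M ∪ upRels L r) :=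
      BooleanSubalgebra.mem_closure_of_mem (Or.inl ⟨D, hD, Or.inl rfl⟩)
    convert BooleanSubalgebra.inf_mem hun hfin using 1
    ext ⟨x, b⟩
    simp only [Set.mem_ofPred_eq, Set.inf_eq_inter, Set.mem_inter_iff, Finset.sup_set_eq_biUnion,
      Set.mem_iUnion, Set.mem_sdiff, U]
    rw [and_comm]
    refine and_congr_right fun hx => ?_
    have := mem_iff_exists_alt hr (hn b) hx
    simpa [and_left_comm] using this
  · intro C D hC hD
    convert BooleanSubalgebra.sup_mem hC hD using 1
    ext p
    simp only [Set.mem_ofPred_eq, Set.mem_union, Set.sup_eq_union]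
    tauto

/-- The order which compares the fibers of `U` by reverse inclusion, and elements with the same
fiber by `r`. -/
def fiberOrder (r : M → M → Prop) (U : Set (M × M)) (b b' : M) : Prop :=
  (∀ a, (a, b') ∈ U → (a, b) ∈ U) ∧ ((∀ a, (a, b) ∈ U → (a, b') ∈ U) → r b b')

/-- The fibres are up-sets of a linear order, hence comparable by inclusion; `r` breaks the ties. -/
theorem isStrictTotalOrder_fiberOrder {r : M → M → Prop} (hr : IsStrictTotalOrder M r)
    {U : Set (M × M)} (hU : ∀ a a' b, r a a' → (a, b) ∈ U → (a', b) ∈ U) :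
    IsStrictTotalOrder M (fiberOrder r U) := by
  have htot : ∀ b b', (∀ a, (a, b') ∈ U → (a, b) ∈ U) ∨ (∀ a, (a, b) ∈ U → (a, b') ∈ U) := by
    intro b b'
    by_contra! hno
    obtain ⟨⟨a, h1, h2⟩, ⟨c, h3, h4⟩⟩ := hno
    by_cases hac : r a c
    · exact h4 (hU _ _ _ hac h1)
    by_cases hca : r c a
    · exact h2 (hU _ _ _ hca h3)
    obtain rfl := hr.trichotomous _ _ hac hca
    exact h2 h3
  refine { trichotomous := ?_, irrefl := ?_, trans := ?_ }
  · intro b b' h1 h2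
    have h := htot b b'
    unfold fiberOrder at h1 h2
    have h3 : ¬ r b b' := by tauto
    have h4 : ¬ r b' b := by tauto
    exact hr.trichotomous _ _ h3 h4
  · exact fun b h => hr.irrefl b (h.2 fun _ h => h)
  · intro a b c h1 h2
    refine ⟨fun x hx => h1.1 x (h2.1 x hx), fun h => ?_⟩
    exact hr.trans _ _ _ (h1.2 fun x hx => h2.1 x (h x hx)) (h2.2 fun x hx => h x (h1.1 x hx))

theorem definable_fiberOrder {r : M → M → Prop} (hr : DefinableRel L r) {U : Set (M × M)}
    (hU : (∅ : Set M).Definable₂ L U) : DefinableRel L (fiberOrder r U) := by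
  have hU' := definableRel_mem hU
  refine definableRel_of (r := fiberOrder r U) ?_
  unfold fiberOrder
  apply_rules [DefPred.and, DefPred.imp, DefPred.all, hr.app, hU'.app] <;> exact ⟨_, fun _ => rfl⟩

theorem weaklyMonotoneRels_subset (r : M → M → Prop) :
    weaklyMonotoneRels L r ⊆ specialMonotoneRels L r := by
  rintro R ⟨hR, s, ⟨Es, h1, h2, -, h4⟩, hs⟩
  exact ⟨hR, s, ⟨Es, h1, h2, h4⟩, hs⟩

/-- The complement of `U` is down-closed in the first variable, and its fibres grow along
`fiberOrder`. Where that order equals some `r_E`, closing the complement under monotonicity adds no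
new pairs over the piece. -/
theorem upRels_subset_closure {r : M → M → Prop} (hr : IsStrictTotalOrder M r)
    (hrd : DefinableRel L r) (h : UniformlyTame L r) {U : Set (M × M)} (hU : U ∈ upRels L r) :
    U ∈ BooleanSubalgebra.closure (unarySets L M ∪ weaklyMonotoneRels L r) := by
  obtain ⟨hUd, hU⟩ := hU
  have hU' := definableRel_mem hUd
  rw [← BooleanSubalgebra.compl_mem_iff]
  have hcover := h.exists_seqOrder hr hrd (isStrictTotalOrder_fiberOrder hr hU)
    (definable_fiberOrder hrd hUd)
  have key := hcover.of_union
    (Q := fun D => {p : M × M | p ∉ U ∧ p.2 ∈ D} ∈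
      BooleanSubalgebra.closure (unarySets L M ∪ weaklyMonotoneRels L r)) ?_ ?_
  · convert key using 1
    ext p
    simp
  · rintro D ⟨hD, Es, hEd, hadm, hdec, hres⟩
    have hs := isStrictTotalOrder_seqOrder hr hadm
    have hsd := hrd.seqOrder hEd
    -- The monotone closure of the part of the complement of `U` lying over `D`.
    let V : Set (M × M) := {p | ∃ a b, b ∈ D ∧ (a, b) ∉ U ∧ (p.1 = a ∨ r p.1 a) ∧
      (b = p.2 ∨ seqOrder r Es b p.2)}
    have hle : ∀ {q : M → M → Prop} {x y z : M}, IsStrictTotalOrder M q → (x = y ∨ q x y) →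
        (y = z ∨ q y z) → (x = z ∨ q x z) := by
      rintro q x y z hq (rfl | h) (rfl | h')
      exacts [Or.inl rfl, Or.inr h', Or.inr h, Or.inr (hq.trans _ _ _ h h')]
    have hV : V ∈ weaklyMonotoneRels L r := by
      refine ⟨?_, _, ⟨Es, hEd, hadm, hdec, rfl⟩, ?_⟩
      · refine definableRel_of (r := fun x y => ∃ a b, b ∈ D ∧ (a, b) ∉ U ∧ (x = a ∨ r x a) ∧
          (b = y ∨ seqOrder r Es b y)) ?_
        apply_rules [DefPred.and, DefPred.or, DefPred.not, DefPred.ex, DefPred.eq, hrd.app,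
          hU'.app, hsd.app, hD.mem] <;> exact ⟨_, fun _ => rfl⟩
      · rintro a a' b' b ha ⟨c, d, hd, hcd, hac, hdb⟩ hb
        exact ⟨c, d, hd, hcd, hle hr ha hac, hle hs hdb hb⟩
    have hun : {p : M × M | p.2 ∈ D} ∈
        BooleanSubalgebra.closure (unarySets L M ∪ weaklyMonotoneRels L r) :=
      BooleanSubalgebra.mem_closure_of_mem (Or.inl ⟨D, hD, Or.inr rfl⟩)
    convert BooleanSubalgebra.inf_mem hun (BooleanSubalgebra.mem_closure_of_mem (Or.inr hV)) using 1
    ext ⟨x, y⟩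
    constructor
    · rintro ⟨h1, h2⟩
      exact ⟨h2, x, y, h2, h1, Or.inl rfl, Or.inl rfl⟩
    · rintro ⟨h2, a, b, hb, hab, hxa, hby⟩
      refine ⟨fun hxy => hab ?_, h2⟩
      have hxb : (x, b) ∈ U := by
        rcases hby with rfl | hby
        · exact hxy
        · exact ((hres b hb y h2).mpr hby).1 x hxy
      rcases hxa with rfl | hxa
      exacts [hxb, hU _ _ _ hxa hxb]
  · intro C D hC hD
    convert BooleanSubalgebra.sup_mem hC hD using 1
    ext p
    simp only [Set.mem_ofPred_eq, Set.mem_union, Set.sup_eq_union]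
    tauto

theorem mem_closure_weaklyMonotoneRels {r : M → M → Prop} (hr : IsStrictTotalOrder M r)
    (hrd : DefinableRel L r) (h : UniformlyTame L r) {R : Set (M × M)}
    (hR : (∅ : Set M).Definable₂ L R) :
    R ∈ BooleanSubalgebra.closure (unarySets L M ∪ weaklyMonotoneRels L r) := by
  refine BooleanSubalgebra.closure_le.mpr ?_ (mem_closure_upRels hr hrd h hR)
  rintro U (hU | hU)
  · exact BooleanSubalgebra.mem_closure_of_mem (Or.inl hU)
  · exact upRels_subset_closure hr hrd h hU

end BinaryRelations

/-! ### Cells and projections in the algebra of binary conditions. -/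

section BinaryAlgebra

variable {L : FirstOrder.Language.{u, v}} {M : Type w} [L.Structure M] {ι κ : Type*}

variable (L M ι) in
/-- The Boolean algebra generated by the definable unary and binary conditions on tuples. -/
def binAlgebra : BooleanSubalgebra (Set (ι → M)) :=
  BooleanSubalgebra.closure ({A | ∃ D i, DefinableSet L D ∧ A = {v | v i ∈ D}} ∪
    {A | ∃ S i j, DefinableRel L S ∧ A = {v | S (v i) (v j)}})

theorem unary_mem_binAlgebra {D : Set M} (hD : DefinableSet L D) (i : ι) :
    {v | v i ∈ D} ∈ binAlgebra L M ι :=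
  BooleanSubalgebra.mem_closure_of_mem (Or.inl ⟨D, i, hD, rfl⟩)

theorem binary_mem_binAlgebra {S : M → M → Prop} (hS : DefinableRel L S) (i j : ι) :
    {v | S (v i) (v j)} ∈ binAlgebra L M ι :=
  BooleanSubalgebra.mem_closure_of_mem (Or.inr ⟨S, i, j, hS, rfl⟩)

theorem const_mem_binAlgebra (p : Prop) : {_v : ι → M | p} ∈ binAlgebra L M ι := by
  by_cases hp : p
  · convert (binAlgebra L M ι).top_mem using 1
    simp [hp]
  · convert (binAlgebra L M ι).bot_mem using 1
    simp [hp]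

variable (L) in
/-- `U` is a constant family or a definable family of `r`-up-sets which depends on one
coordinate. -/
def IsFamily (r : M → M → Prop) (U : (ι → M) → Set M) : Prop :=
  (∃ p : Prop, U = fun _ => {_x | p}) ∨ ∃ S i, DefinableRel L S ∧
    (∀ b x x', r x x' → S x b → S x' b) ∧ U = fun v => {x | S x (v i)}

theorem IsFamily.compl {r : M → M → Prop} {U : (ι → M) → Set M} (h : IsFamily L r U) :
    IsFamily L (fun x y => r y x) fun v => (U v)ᶜ := by
  rcases h with ⟨p, rfl⟩ | ⟨S, i, hS, hup, rfl⟩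
  · exact Or.inl ⟨¬ p, rfl⟩
  · refine Or.inr ⟨fun x y => ¬ S x y, i, ?_, fun b x x' hx h h' => h (hup b _ _ hx h'), rfl⟩
    exact definableRel_of (DefPred.not (hS.app ⟨_, fun _ => rfl⟩ ⟨_, fun _ => rfl⟩))

theorem isFamily_univ (r : M → M → Prop) : IsFamily L r fun _ : ι → M => Set.univ :=
  Or.inl ⟨True, by ext; simp⟩

theorem IsFamily.total {r : M → M → Prop} (hr : IsStrictTotalOrder M r) {U V : (ι → M) → Set M}
    (hU : IsFamily L r U) (hV : IsFamily L r V) (v : ι → M) : U v ⊆ V v ∨ V v ⊆ U v := by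
  have up : ∀ {U}, IsFamily L r U → ∀ x x', r x x' → x ∈ U v → x' ∈ U v := by
    rintro U (⟨p, rfl⟩ | ⟨S, i, hS, hup, rfl⟩) x x' hx h
    exacts [h, hup _ _ _ hx h]
  by_contra! h
  obtain ⟨⟨x, h1, h2⟩, ⟨y, h3, h4⟩⟩ := h.imp Set.not_subset.mp Set.not_subset.mp
  by_cases hxy : r x y
  · exact h4 (up hU _ _ hxy h1)
  by_cases hyx : r y x
  · exact h2 (up hV _ _ hyx h3)
  obtain rfl := hr.trichotomous _ _ hxy hyx
  exact h2 h3

/-- Each family depends on at most one coordinate, so a definable condition on two of them involves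
at most two coordinates. -/
theorem IsFamily.mem_binAlgebra {r r' : M → M → Prop} {U V : (ι → M) → Set M}
    (hU : IsFamily L r U) (hV : IsFamily L r' V) (Q : Set M → Set M → Prop)
    (hQ : ∀ S S', DefinableRel L S → DefinableRel L S' →
      DefinableRel L fun b c => Q {x | S x b} {x | S' x c}) :
    {v | Q (U v) (V v)} ∈ binAlgebra L M ι := by
  have hc : ∀ p : Prop, DefinableRel L fun _ _ : M => p := fun p => DefPred.const p
  rcases hU with ⟨p, rfl⟩ | ⟨S, i, hS, -, rfl⟩ <;> rcases hV with ⟨p', rfl⟩ | ⟨S', j, hS', -, rfl⟩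
  · exact const_mem_binAlgebra _
  · exact binary_mem_binAlgebra (hQ _ _ (hc p) hS') j j
  · exact binary_mem_binAlgebra (hQ _ _ hS (hc p')) i i
  · exact binary_mem_binAlgebra (hQ _ _ hS hS') i j

theorem IsFamily.subset_mem_binAlgebra {r : M → M → Prop} {U V : (ι → M) → Set M}
    (hU : IsFamily L r U) (hV : IsFamily L r V) : {v | U v ⊆ V v} ∈ binAlgebra L M ι := by
  refine hU.mem_binAlgebra hV (· ⊆ ·) fun S S' hS hS' => ?_
  refine definableRel_of (r := fun b c => ∀ x, S x b → S' x c) ?_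
  apply_rules [DefPred.imp, DefPred.all, hS.app, hS'.app] <;> exact ⟨_, fun _ => rfl⟩

/-- The set of the pairs `(x, v)` with `v ∈ B` and `x ∈ D ∩ U v ∩ V v`. -/
def cell (B : Set (ι → M)) (D : Set M) (U V : (ι → M) → Set M) : Set (M × (ι → M)) :=
  {p | p.2 ∈ B ∧ p.1 ∈ D ∧ p.1 ∈ U p.2 ∧ p.1 ∈ V p.2}

variable (L) in
/-- `C` is a cell cut out by an up-set and a down-set. -/
def IsCell (r : M → M → Prop) (C : Set (M × (ι → M))) : Prop :=
  ∃ B D U V, B ∈ binAlgebra L M ι ∧ DefinableSet L D ∧ IsFamily L r U ∧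
    IsFamily L (fun x y => r y x) V ∧ C = cell B D U V

variable {r : M → M → Prop}

/-- Up-sets are comparable, and so are down-sets. Splitting the base by which of the two is smaller,
itself a binary condition, leaves a single up-set and a single down-set in each of four cells. -/
theorem IsCell.inter (hr : IsStrictTotalOrder M r) {C C' : Set (M × (ι → M))}
    (hC : IsCell L r C) (hC' : IsCell L r C') : FinCover (IsCell L r) (C ∩ C') := by
  obtain ⟨B, D, U, V, hB, hD, hU, hV, rfl⟩ := hC
  obtain ⟨B', D', U', V', hB', hD', hU', hV', rfl⟩ := hC'
  have hr' : IsStrictTotalOrder M fun x y => r y x :=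
    { trichotomous := fun a b h h' => hr.trichotomous a b h' h
      irrefl := hr.irrefl
      trans := fun a b c h h' => hr.trans _ _ _ h' h }
  have hBB := BooleanSubalgebra.inf_mem hB hB'
  have hW := hU.subset_mem_binAlgebra hU'
  have hW' := hV.subset_mem_binAlgebra hV'
  have tot := hU.total hr hU'
  have tot' := hV.total hr' hV'
  have hDD := hD.inter hD'
  have heq : cell B D U V ∩ cell B' D' U' V' =
      (cell (((B ⊓ B') ⊓ {v | U v ⊆ U' v}) ⊓ {v | V v ⊆ V' v}) (D ∩ D') U V ∪
        cell (((B ⊓ B') ⊓ {v | U v ⊆ U' v}) \ {v | V v ⊆ V' v}) (D ∩ D') U V') ∪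
      (cell (((B ⊓ B') \ {v | U v ⊆ U' v}) ⊓ {v | V v ⊆ V' v}) (D ∩ D') U' V ∪
        cell (((B ⊓ B') \ {v | U v ⊆ U' v}) \ {v | V v ⊆ V' v}) (D ∩ D') U' V') := by
    ext ⟨x, v⟩
    have t := tot v
    have t' := tot' v
    simp only [cell, Set.mem_inter_iff, Set.mem_union, Set.mem_ofPred_eq, Set.inf_eq_inter,
      Set.mem_sdiff]
    by_cases h1 : U v ⊆ U' v <;> by_cases h2 : V v ⊆ V' v
    · simp only [h1, h2, and_true, and_false, false_and, not_true_eq_false, or_false]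
      exact ⟨fun ⟨⟨b, d, u, w⟩, b', d', u', w'⟩ => ⟨⟨b, b'⟩, ⟨d, d'⟩, u, w⟩,
        fun ⟨⟨b, b'⟩, ⟨d, d'⟩, u, w⟩ => ⟨⟨b, d, u, w⟩, b', d', h1 u, h2 w⟩⟩
    · simp only [h1, h2, and_true, and_false, false_and, not_true_eq_false, not_false_eq_true,
        or_false, false_or]
      exact ⟨fun ⟨⟨b, d, u, w⟩, b', d', u', w'⟩ => ⟨⟨b, b'⟩, ⟨d, d'⟩, u, w'⟩,
        fun ⟨⟨b, b'⟩, ⟨d, d'⟩, u, w⟩ => ⟨⟨b, d, u, t'.resolve_left h2 w⟩, b', d', h1 u, w⟩⟩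
    · simp only [h1, h2, and_true, and_false, false_and, not_true_eq_false, not_false_eq_true,
        or_false, false_or]
      exact ⟨fun ⟨⟨b, d, u, w⟩, b', d', u', w'⟩ => ⟨⟨b, b'⟩, ⟨d, d'⟩, u', w⟩,
        fun ⟨⟨b, b'⟩, ⟨d, d'⟩, u, w⟩ => ⟨⟨b, d, t.resolve_left h1 u, w⟩, b', d', u, h2 w⟩⟩
    · simp only [h1, h2, and_true, and_false, false_and, not_false_eq_true, or_false,
        false_or]
      exact ⟨fun ⟨⟨b, d, u, w⟩, b', d', u', w'⟩ => ⟨⟨b, b'⟩, ⟨d, d'⟩, u', w'⟩,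
        fun ⟨⟨b, b'⟩, ⟨d, d'⟩, u, w⟩ => ⟨⟨b, d, t.resolve_left h1 u, t'.resolve_left h2 w⟩, b', d', u, w⟩⟩
  rw [heq]
  refine .union (.union (.base ?_) (.base ?_)) (.union (.base ?_) (.base ?_))
  · exact ⟨_, _, _, _, BooleanSubalgebra.inf_mem (BooleanSubalgebra.inf_mem hBB hW) hW', hDD,
      hU, hV, rfl⟩
  · exact ⟨_, _, _, _, BooleanSubalgebra.sdiff_mem (BooleanSubalgebra.inf_mem hBB hW) hW', hDD,
      hU, hV', rfl⟩
  · exact ⟨_, _, _, _, BooleanSubalgebra.inf_mem (BooleanSubalgebra.sdiff_mem hBB hW) hW', hDD,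
      hU', hV, rfl⟩
  · exact ⟨_, _, _, _, BooleanSubalgebra.sdiff_mem (BooleanSubalgebra.sdiff_mem hBB hW) hW', hDD,
      hU', hV', rfl⟩

theorem IsCell.of_mem {B : Set (ι → M)} (hB : B ∈ binAlgebra L M ι) :
    IsCell L r {p | p.2 ∈ B} :=
  ⟨B, _, _, _, hB, definableSet_univ, isFamily_univ _, isFamily_univ _, by simp [cell]⟩

theorem IsCell.of_definable {D : Set M} (hD : DefinableSet L D) :
    IsCell L r {p : M × (ι → M) | p.1 ∈ D} :=
  ⟨_, D, _, _, (binAlgebra L M ι).top_mem, hD, isFamily_univ _, isFamily_univ _, by simp [cell]⟩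

theorem IsCell.of_up {U : (ι → M) → Set M} (hU : IsFamily L r U) :
    IsCell L r {p | p.1 ∈ U p.2} :=
  ⟨_, _, U, _, (binAlgebra L M ι).top_mem, definableSet_univ, hU, isFamily_univ _,
    by simp [cell]⟩

theorem IsCell.of_down {V : (ι → M) → Set M} (hV : IsFamily L (fun x y => r y x) V) :
    IsCell L r {p | p.1 ∈ V p.2} :=
  ⟨_, _, _, V, (binAlgebra L M ι).top_mem, definableSet_univ, isFamily_univ _, hV,
    by simp [cell]⟩

theorem IsCell.finCover_compl {C : Set (M × (ι → M))} (hC : IsCell L r C) :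
    FinCover (IsCell L r) Cᶜ := by
  obtain ⟨B, D, U, V, hB, hD, hU, hV, rfl⟩ := hC
  have heq : (cell B D U V)ᶜ = ({p | p.2 ∈ Bᶜ} ∪ {p | p.1 ∈ Dᶜ}) ∪
      ({p | p.1 ∈ (U p.2)ᶜ} ∪ {p | p.1 ∈ (V p.2)ᶜ}) := by
    ext p
    simp only [cell, Set.mem_compl_iff, Set.mem_union, Set.mem_ofPred_eq]
    tauto
  rw [heq]
  exact .union (.union (.base (.of_mem (BooleanSubalgebra.compl_mem hB)))
    (.base (.of_definable hD.compl))) (.union (.base (.of_down hU.compl))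
    (.base (.of_up hV.compl)))

theorem finCover_isCell_compl (hr : IsStrictTotalOrder M r) {A : Set (M × (ι → M))}
    (hA : FinCover (IsCell L r) A) : FinCover (IsCell L r) Aᶜ := by
  induction hA with
  | base h => exact h.finCover_compl
  | union _ _ ih ih' =>
    rw [Set.compl_union]
    exact ih.inter ih' fun C C' => IsCell.inter hr

theorem finCover_isCell_binary (hr : IsStrictTotalOrder M r) (hrd : DefinableRel L r)
    (h : UniformlyTame L r) {S : M → M → Prop} (hS : DefinableRel L S) (i : ι) :
    FinCover (IsCell L r) {p : M × (ι → M) | S p.1 (p.2 i)} := by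
  have : ∀ R ∈ BooleanSubalgebra.closure (unarySets L M ∪ upRels L r),
      FinCover (IsCell L r) {p : M × (ι → M) | (p.1, p.2 i) ∈ R} := by
    intro R hR
    induction hR using BooleanSubalgebra.closure_bot_sup_induction with
    | mem R hR =>
      rcases hR with ⟨D, hD, rfl | rfl⟩ | ⟨hR, hup⟩
      · exact .base (.of_definable hD)
      · exact .base (.of_mem (unary_mem_binAlgebra hD i))
      · exact .base (.of_up (Or.inr ⟨fun a b => (a, b) ∈ R, i, definableRel_mem hR,
          fun b x x' hx => hup x x' b hx, rfl⟩))
    | bot => exact .base (.of_mem (binAlgebra L M ι).bot_mem)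
    | sup A _ B _ ihA ihB => exact ihA.union ihB
    | compl A _ ih => exact finCover_isCell_compl hr ih
  exact this _ (mem_closure_upRels hr hrd h hS)

/-- The map `σ` sends to `none` the coordinates filled by the distinguished variable, and each other
coordinate to its source in `ι`. -/
theorem finCover_isCell_of_mem (hr : IsStrictTotalOrder M r) (hrd : DefinableRel L r)
    (h : UniformlyTame L r) (σ : κ → Option ι) {A : Set (κ → M)} (hA : A ∈ binAlgebra L M κ) :
    FinCover (IsCell L r) {p : M × (ι → M) | (fun k => (σ k).elim p.1 p.2) ∈ A} := by
  induction hA using BooleanSubalgebra.closure_bot_sup_induction with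
  | mem A hA =>
    rcases hA with ⟨D, k, hD, rfl⟩ | ⟨S, k, l, hS, rfl⟩
    · simp only [Set.mem_ofPred_eq]
      cases σ k with
      | none => exact .base (.of_definable hD)
      | some i => exact .base (.of_mem (unary_mem_binAlgebra hD i))
    · simp only [Set.mem_ofPred_eq]
      cases σ k with
      | none =>
        cases σ l with
        | none => exact .base (.of_definable (definableSet_of (p := fun x => S x x)
            (hS.app ⟨_, fun _ => rfl⟩ ⟨_, fun _ => rfl⟩)))
        | some j => exact finCover_isCell_binary hr hrd h hS j
      | some i =>
        cases σ l with
        | none =>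
          exact finCover_isCell_binary hr hrd h (S := fun x y => S y x)
            (definableRel_of (hS.app ⟨_, fun _ => rfl⟩ ⟨_, fun _ => rfl⟩)) i
        | some j => exact .base (.of_mem (binary_mem_binAlgebra hS i j))
  | bot => exact .base (.of_mem (binAlgebra L M ι).bot_mem)
  | sup A _ B _ ihA ihB => exact ihA.union ihB
  | compl A _ ih => exact finCover_isCell_compl hr ih

/-- The binary algebras are closed under projections. -/
theorem exists_mem_binAlgebra (hr : IsStrictTotalOrder M r) (hrd : DefinableRel L r)
    (h : UniformlyTame L r) (σ : κ → Option ι) {A : Set (κ → M)} (hA : A ∈ binAlgebra L M κ) :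
    {v : ι → M | ∃ x, (fun k => (σ k).elim x v) ∈ A} ∈ binAlgebra L M ι := by
  refine (finCover_isCell_of_mem hr hrd h σ hA).of_union
    (Q := fun C => {v : ι → M | ∃ x, (x, v) ∈ C} ∈ binAlgebra L M ι) ?_ ?_
  · rintro C ⟨B, D, U, V, hB, hD, hU, hV, rfl⟩
    have hUV : {v | ∃ x, x ∈ D ∧ x ∈ U v ∧ x ∈ V v} ∈ binAlgebra L M ι := by
      refine hU.mem_binAlgebra hV (fun A A' => ∃ x, x ∈ D ∧ x ∈ A ∧ x ∈ A') fun S S' hS hS' => ?_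
      refine definableRel_of (r := fun b c => ∃ x, x ∈ D ∧ S x b ∧ S' x c) ?_
      refine DefPred.ex (DefPred.and (hD.mem ⟨_, fun _ => rfl⟩) (DefPred.and ?_ ?_))
      · exact hS.app ⟨_, fun _ => rfl⟩ ⟨_, fun _ => rfl⟩
      · exact hS'.app ⟨_, fun _ => rfl⟩ ⟨_, fun _ => rfl⟩
    convert BooleanSubalgebra.inf_mem hB hUV using 1
    ext v
    simp [cell]
  · intro C C' hC hC'
    convert BooleanSubalgebra.sup_mem hC hC' using 1
    ext v
    simp [exists_or]

end BinaryAlgebra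

/-! ### Quantifier elimination in the binary reduct. -/

section BinaryReduct

open FirstOrder FirstOrder.Language

variable {L : FirstOrder.Language.{u, v}} {M : Type w} [L.Structure M] {r : M → M → Prop}

theorem exists_realize_eq {α : Type*} {n : ℕ} (t : (binLanguage L M).Term (α ⊕ Fin n)) :
    ∃ k, ∀ w : α ⊕ Fin n → M, t.realize w = w k := by
  cases t with
  | var k => exact ⟨k, fun _ => rfl⟩
  | func f => exact f.elim

theorem realize_mem_binAlgebra (hr : IsStrictTotalOrder M r) (hrd : DefinableRel L r)
    (h : UniformlyTame L r) {α : Type*} {n : ℕ} (φ : (binLanguage L M).BoundedFormula α n) :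
    {w : α ⊕ Fin n → M | φ.Realize (w ∘ Sum.inl) (w ∘ Sum.inr)} ∈ binAlgebra L M (α ⊕ Fin n) := by
  induction φ with
  | falsum => exact const_mem_binAlgebra False
  | equal t₁ t₂ =>
    obtain ⟨i, hi⟩ := exists_realize_eq t₁
    obtain ⟨j, hj⟩ := exists_realize_eq t₂
    have : DefinableRel L fun x y : M => x = y :=
      definableRel_of (DefPred.eq ⟨_, fun _ => rfl⟩ ⟨_, fun _ => rfl⟩)
    simp only [BoundedFormula.Realize, Sum.elim_comp_inl_inr, hi, hj]
    exact binary_mem_binAlgebra this i j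
  | @rel n l R ts =>
    choose k hk using fun i => exists_realize_eq (ts i)
    obtain ⟨S, hl, hS⟩ := R
    simp only [BoundedFormula.Realize, Sum.elim_comp_inl_inr, hk]
    rcases hl with rfl | rfl
    · have hD : DefinableSet L {x | ![x] ∈ S} := by
        refine (congrArg (Set.Definable _ L) ?_).mp hS
        ext v
        have : ![v 0] = v := by ext i; fin_cases i; rfl
        simp [this]
      convert unary_mem_binAlgebra hD (k 0) using 1
      ext w
      have : (fun i => w (k i)) = ![w (k 0)] := by ext i; fin_cases i; rfl
      simp only [Set.mem_ofPred_eq, ← this]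
      rfl
    · have hD : DefinableRel L fun x y => ![x, y] ∈ S := by
        refine (congrArg (Set.Definable _ L) ?_).mp hS
        ext v
        have : ![v 0, v 1] = v := by ext i; fin_cases i <;> rfl
        simp [this]
      convert binary_mem_binAlgebra hD (k 0) (k 1) using 1
      ext w
      have : (fun i => w (k i)) = ![w (k 0), w (k 1)] := by ext i; fin_cases i <;> rfl
      simp only [Set.mem_ofPred_eq, ← this]
      rfl
  | imp φ ψ ihφ ihψ =>
    convert BooleanSubalgebra.sup_mem (BooleanSubalgebra.compl_mem ihφ) ihψ using 1
    ext w
    simp [imp_iff_not_or]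
  | @all n φ ih =>
    -- The last bound variable is the one projected away; the universal quantifier is the complement
    -- of a projection of the complement.
    let σ : α ⊕ Fin (n + 1) → Option (α ⊕ Fin n) :=
      Sum.elim (fun a => some (Sum.inl a)) (Fin.snoc (fun i => some (Sum.inr i)) none)
    convert BooleanSubalgebra.compl_mem (exists_mem_binAlgebra hr hrd h σ
      (BooleanSubalgebra.compl_mem ih)) using 1
    ext w
    have e1 : ∀ x : M, (fun k => (σ k).elim x w) ∘ Sum.inl = w ∘ Sum.inl := fun x => rfl
    have e2 : ∀ x : M, (fun k => (σ k).elim x w) ∘ Sum.inr =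
        (Fin.snoc (w ∘ Sum.inr) x : Fin (n + 1) → M) := by
      intro x
      ext i
      refine Fin.lastCases ?_ (fun i => ?_) i <;> simp [σ]
    simp only [BoundedFormula.realize_all, Set.mem_ofPred_eq, Set.mem_compl_iff, e1, e2,
      not_exists, not_not]

theorem exists_isQF {n : ℕ} {A : Set (Fin n → M)} (hA : A ∈ binAlgebra L M (Fin n)) :
    ∃ ψ : (binLanguage L M).Formula (Fin n), BoundedFormula.IsQF ψ ∧
      ∀ v, ψ.Realize v ↔ v ∈ A := by
  induction hA using BooleanSubalgebra.closure_bot_sup_induction with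
  | mem A hA =>
    rcases hA with ⟨D, i, hD, rfl⟩ | ⟨S, i, j, hS, rfl⟩
    · let R : (binLanguage L M).Relations 1 := ⟨{x | x 0 ∈ D}, Or.inl rfl, hD⟩
      exact ⟨R.formula ![Term.var i], (BoundedFormula.IsAtomic.rel _ _).isQF, fun v =>
        Formula.realize_rel⟩
    · let R : (binLanguage L M).Relations 2 := ⟨{x | S (x 0) (x 1)}, Or.inr rfl, hS⟩
      exact ⟨R.formula ![Term.var i, Term.var j], (BoundedFormula.IsAtomic.rel _ _).isQF, fun v =>
        Formula.realize_rel⟩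
  | bot => exact ⟨⊥, BoundedFormula.isQF_bot, fun v => Iff.rfl⟩
  | sup A _ B _ ihA ihB =>
    obtain ⟨φ, hφ, hA⟩ := ihA
    obtain ⟨ψ, hψ, hB⟩ := ihB
    exact ⟨φ ⊔ ψ, hφ.sup hψ, fun v => by simp [Formula.realize_sup, hA, hB]⟩
  | compl A _ ih =>
    obtain ⟨φ, hφ, hA⟩ := ih
    exact ⟨φ.not, hφ.not, fun v => by simp [Formula.realize_not, hA]⟩

theorem models_completeTheory_of_forall {L' : FirstOrder.Language} {N : Type*} [L'.Structure N]
    [Nonempty N] {n : ℕ} {χ : L'.Formula (Fin n)} (h : ∀ v : Fin n → N, χ.Realize v) :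
    L'.completeTheory N ⊨ᵇ χ := by
  rw [Theory.models_formula_iff]
  intro K v
  let τ : L'.Sentence := Formula.iAlls (Fin n) (χ.relabel Sum.inr)
  have hτ : τ ∈ L'.completeTheory N := by
    rw [mem_completeTheory]
    simpa [τ, Sentence.Realize, Formula.realize_iAlls, Formula.realize_relabel,
      Function.comp_def] using h
  have := Theory.realize_sentence_of_mem (M := K) _ hτ
  simp only [τ, Sentence.Realize, Formula.realize_iAlls, Formula.realize_relabel,
    Function.comp_def, Sum.elim_inr] at this
  exact this v

theorem eliminatesQuantifiers_binReduct [Nonempty M] (hr : IsStrictTotalOrder M r)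
    (hrd : DefinableRel L r) (h : UniformlyTame L r) :
    EliminatesQuantifiers ((binLanguage L M).completeTheory M) := by
  intro n φ
  -- No coordinate is sent to `none`: the projection lemma is used only to reindex, with a dummy
  -- variable, which needs `M` nonempty.
  let σ : Fin n ⊕ Fin 0 → Option (Fin n) := Sum.elim some Fin.elim0
  obtain ⟨ψ, hψ, hA⟩ := exists_isQF
    (exists_mem_binAlgebra hr hrd h σ (realize_mem_binAlgebra hr hrd h φ))
  refine ⟨ψ, hψ, models_completeTheory_of_forall (χ := Formula.iff φ ψ) fun v => ?_⟩
  rw [Formula.realize_iff, hA]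
  have e : ∀ x : M, (fun k => (σ k).elim x v) ∘ Sum.inl = v := fun x => rfl
  have e' : ∀ x : M, (fun k => (σ k).elim x v) ∘ Sum.inr = (default : Fin 0 → M) :=
    fun _ => Subsingleton.elim _ _
  simp only [Set.mem_ofPred_eq, e, e', exists_const, Formula.Realize]

end BinaryReduct

end WQOM

/-! ### The two conclusions combined. -/

theorem corollary2 {L : FirstOrder.Language.{u, v}} (T : L.Theory) (hT : T.IsComplete)
    (hinf : ∃ N : FirstOrder.Language.Theory.ModelType.{u, v, max u v} T, Infinite N)
    (hw : WQOM.IsWeaklyQuasiOMinimal T)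
    (M : FirstOrder.Language.Theory.ModelType.{u, v, w} T) :
    WQOM.EliminatesQuantifiers ((WQOM.binLanguage L M).completeTheory M) ∧
    ∀ r : M → M → Prop, IsStrictTotalOrder M r → WQOM.DefinableRel L r →
      ∀ R : Set (M × M), (∅ : Set M).Definable₂ L R →
        R ∈ BooleanSubalgebra.closure (WQOM.unarySets L M ∪ WQOM.weaklyMonotoneRels L r) ∧
        R ∈ BooleanSubalgebra.closure (WQOM.unarySets L M ∪ WQOM.specialMonotoneRels L r) := by
  obtain ⟨lt, hlt⟩ := hw
  have hM := hlt.isStrictTotalOrder M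
  have hMd : WQOM.DefinableRel L fun a b : M => lt.Realize ![a, b] :=
    Set.empty_definable_iff.mpr ⟨lt, by
      ext v
      have : ![v 0, v 1] = v := by ext i; fin_cases i <;> rfl
      simp [this]⟩
  have hU := hlt.uniformlyTame M
  refine ⟨WQOM.eliminatesQuantifiers_binReduct hM hMd hU, fun r hr hrd R hR => ?_⟩
  -- The order `r` is arbitrary, so tameness is first transferred to it from the distinguished
  -- order.
  have := WQOM.mem_closure_weaklyMonotoneRels hr hrd (hU.transfer hM hMd hr hrd) hR
  exact ⟨this, BooleanSubalgebra.closure_mono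
    (Set.union_subset_union_right _ (WQOM.weaklyMonotoneRels_subset r)) this⟩
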